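/- **Conventions.** A *leg* is a finite set of pairs $a|x$ (outcome $a$, setting $x$). A system of measurement operators $A=\{A_{a|x}\}$ on a Hilbert space is a family of positive operators with $\sum_a A_{a|x}=\mathbb I$ for every $x$; it is projective if all $A_{a|x}$ are projectors. A $q$-partite Bell functional is a real tensor $\mathsf B^{\vec a|\vec x}$, with $\mathsf B[A]=\sum_{\vec a,\vec x}\mathsf B^{\vec a|\vec x}\bigotimes_k A^{(k)}_{a_k|x_k}$; it is *normalized* if the maximum of $\langle\psi|\mathsf B[A]|\psi\rangle$ over all Hilbert spaces $H_k'$ (of any dimension), all systems of measurement operators $A^{(k)}$ on $H'_k$ (POVMs, not necessarily projective) and all unit vectors $\psi\in\bigotimes_kH_k'$ equals $1$. A tensor polynomial of $A$ is a complex linear combination of products of operators $\mathbb I\otimes\dots\otimes A^{(k)}_{a|x}\otimes\dots\otimes\mathbb I$. **Full self-testing.** Let $\bar A^{(k)}$ be projective measurement systems on finite-dimensional Hilbert spaces $H_k$, and $\bar\psi\in\bigotimes_k H_k$ a unit vector with $\{f[\bar A]\bar\psi: f \text{ tensor polynomial}\}=\bigotimes_kH_k$. A normalized Bell functional $\mathsf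 B$ *fully self-tests* $(\bar\psi,\bar A)$ if for every choice of Hilbert spaces $H'_k$, systems of measurement operators $A^{(k)}$ on $H'_k$ (POVMs, not necessarily projective) and unit vector $\psi\in\bigotimes_kH'_k$ with $\langle\psi|\mathsf B[A]|\psi\rangle=1$ there are orthonormal bases $\{|i_k\rangle\}$ of the $H_k$, orthonormal vectors $\psi(\vec i)\in\bigotimes_kH'_k$ with $\psi=\sum_{\vec i}\langle \vec i|\bar\psi\rangle\,\psi(\vec i)$, Hilbert spaces $K_k$, isometries $U_k:H'_k\to H_k\otimes K_k$ and a unit vector $|\mathrm{junk}\rangle\in\bigotimes_kK_k$ such that $$\Big(\bigotimes_kU_k\Big)\Big(\bigotimes_kA^{(k)}_{a_k|x_k}\Big)\psi(\vec i)=\Big(\bigotimes_k\bar A^{(k)}_{a_k|x_k}\,|\vec i\rangle\Big)\otimes|\mathrm{junk}\rangle\qquad\text{for all }\vec a,\vec x,\vec i.$$ **Connector complexes.** A (normalized) $q\to1$ connector is a real tensor $\mathsf C^{\vec a|\vec x}_{b|y}$ such that, for all systems of measurement operators $A^{(1)},\dots,A^{(q)}$, the operators $\mathsf C[A]=\{\mathsf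 C_{b|y}[A]\}$ form a system of measurement operators. A *connector complex* is $\mathcal C=(\mathsf C,\bar A,V)$ with $\mathsf C$ a connector, $\bar A^{(k)}$ measurement systems on finite-dimensional $H_k$ and $V:\bigotimes_kH_k\to H$ a coisometry ($VV^\dagger=\mathbb I$) such that $\bar M_{b|y}:=V\mathsf C_{b|y}[\bar A]V^\dagger$ is a projective measurement system; $I(\mathcal C)$ is the range of $V^\dagger$. It is *fully self-testing*, with real coefficients $\mu=(\mu_{b|y})$ and state $\bar\psi\in I(\mathcal C)$, if $\mu\mathsf C:=\sum_{b,y}\mu_{b|y}\mathsf C_{b|y}$ is normalized and fully self-tests $(\bar\psi,\bar A)$, and $I(\mathcal C)=\{f[\mathsf C[\bar A]]\bar\psi: f\text{ polynomial}\}$. Plugging the output leg of $\mathcal C_1$ into the $k$-th input leg of $\mathcal C_2$ (with the same labels and the same Hilbert space) is *congruent* if $\bar M(\mathcal C_1)=\bar A^{(k)}(\mathcal C_2)$. The contraction has as connector the contracted tensor, as measurements those of the remaining legs, coisometry $V=V(\mathcal C_2)(\mathbb I\otimes V(\mathcal C_1)\otimes\mathbb I)$ with $V(\mathcal C_1)$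 producing factor $k$, coefficients $\mu=\mu(\mathcal C_2)$ and state $\bar\psi=(\mathbb I\otimes V(\mathcal C_1)^\dagger\otimes\mathbb I)\,\bar\psi(\mathcal C_2)$. **Proposition.** Let $\mathcal C^{(n)}$ be obtained from $n\ge1$ fully self-testing connector complexes by successive congruent contractions (forming a tree with one root), and let $\mu(\mathcal C^{(n)})$ and the tensor network state $\bar\psi(\mathcal C^{(n)})$ be the coefficients and state given by the above rule. Then $\mathcal C^{(n)}$ is a connector complex, and the Bell inequality $\langle\mu(\mathcal C^{(n)})\,\mathsf C(\mathcal C^{(n)})[A]\rangle\le1$ is normalized and fully self-tests $\big(\bar\psi(\mathcal C^{(n)}),\bar A(\mathcal C^{(n)})\big)$. -/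

import Mathlib

namespace TightConnectors

/-! ### Hilbert spaces and their tensor products

Every complex Hilbert space has an orthonormal basis, hence is of the form `ℓ²(I)`; finite-dimensional
spaces are those with finite `I`. The Hilbert space tensor product of the spaces `ℓ²(I k)` is
`ℓ²(∀ k, I k)`, the product basis vectors being indexed by tuples. -/

/-- The Hilbert space `ℓ²(I)`. -/
abbrev Hilb (I : Type) : Type := lp (fun _ : I => ℂ) 2

/-- Bounded operators between two such spaces. -/
abbrev Op (I J : Type) : Type := Hilb I →L[ℂ] Hilb J

/-- The basis vector `|i⟩` of `ℓ²(I)`. -/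
noncomputable def ket {I : Type} (i : I) : Hilb I :=
  @lp.single I (fun _ => ℂ) _ (Classical.decEq I) 2 i 1

theorem hilb_norm_sq {I : Type} (f : Hilb I) : ‖f‖ ^ 2 = ∑' i, ‖f i‖ ^ 2 := by
  have := lp.norm_rpow_eq_tsum (p := 2) (by norm_num) f
  simpa using this

theorem hilb_summable {I : Type} (f : Hilb I) : Summable fun i => ‖f i‖ ^ 2 := by
  have := (lp.memℓp f).summable (by norm_num)
  simpa using this

theorem memHilb {I : Type} {f : I → ℂ} (h : Summable fun i => ‖f i‖ ^ 2) :
    Memℓp (E := fun _ : I => ℂ) f 2 := by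
  refine memℓp_gen ?_
  simpa using h

/-- Relabelling of the basis. -/
noncomputable def reindex {I J : Type} (e : I ≃ J) : Hilb I ≃ₗᵢ[ℂ] Hilb J where
  toFun f := ⟨fun j => f (e.symm j),
    memHilb ((e.symm.summable_iff (f := fun i => ‖f i‖ ^ 2)).2 (hilb_summable f))⟩
  invFun f := ⟨fun i => f (e i),
    memHilb ((e.summable_iff (f := fun j => ‖f j‖ ^ 2)).2 (hilb_summable f))⟩
  map_add' f g := rfl
  map_smul' c f := rfl
  left_inv f := by apply lp.ext; funext i; simp
  right_inv f := by apply lp.ext; funext i; simp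
  norm_map' f := by
    refine (pow_left_inj₀ (norm_nonneg _) (norm_nonneg _) two_ne_zero).1 ?_
    rw [hilb_norm_sq, hilb_norm_sq]
    exact e.symm.tsum_eq (fun i => ‖f i‖ ^ 2)

/-- Relabelling of the basis, as an operator. -/
noncomputable def reindexOp {I J : Type} (e : I ≃ J) : Op I J :=
  (reindex e).toContinuousLinearEquiv.toContinuousLinearMap

/-- The component of a vector of `ℓ²(I) ⊗ ℓ²(K)` along the basis vector `|c⟩` of `ℓ²(K)`. -/
noncomputable def slice {I K : Type} (f : Hilb (I × K)) (c : K) : Hilb I :=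
  ⟨fun i => f (i, c), memHilb ((hilb_summable f).comp_injective (Prod.mk_left_injective c))⟩

theorem slice_hasSum {I K : Type} (f : Hilb (I × K)) :
    HasSum (fun c => ‖slice f c‖ ^ 2) (‖f‖ ^ 2) := by
  have h1 : Summable fun p : K × I => ‖f p.swap‖ ^ 2 :=
    ((Equiv.prodComm K I).summable_iff (f := fun p => ‖f p‖ ^ 2)).2 (hilb_summable f)
  have h2 : ∑' p : K × I, ‖f p.swap‖ ^ 2 = ‖f‖ ^ 2 := by
    rw [hilb_norm_sq]
    exact (Equiv.prodComm K I).tsum_eq (fun p => ‖f p‖ ^ 2)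
  have h3 := h1.hasSum.prod_fiberwise (fun c => (h1.prod_factor c).hasSum)
  rw [h2] at h3
  convert h3 using 2 with c
  exact hilb_norm_sq _

theorem ampl_summable {I J K : Type} (T : Op I J) (f : Hilb (I × K)) :
    Summable fun p : J × K => ‖T (slice f p.2) p.1‖ ^ 2 := by
  rw [← (Equiv.prodComm K J).summable_iff]
  refine (summable_prod_of_nonneg (fun p => sq_nonneg _)).2
    ⟨fun c => hilb_summable (T (slice f c)), ?_⟩
  refine Summable.of_nonneg_of_le (fun c => tsum_nonneg fun _ => sq_nonneg _) (fun c => ?_)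
    ((slice_hasSum f).summable.mul_left (‖T‖ ^ 2))
  calc _ = ‖T (slice f c)‖ ^ 2 := (hilb_norm_sq _).symm
    _ ≤ (‖T‖ * ‖slice f c‖) ^ 2 := by gcongr; exact T.le_opNorm _
    _ = _ := by ring

/-- The operator `T ⊗ 𝟙` on `ℓ²(I) ⊗ ℓ²(K)`. -/
noncomputable def ampl {I J : Type} (K : Type) (T : Op I J) : Op (I × K) (J × K) :=
  LinearMap.mkContinuous
    { toFun := fun f => (⟨fun p => T (slice f p.2) p.1, memHilb (ampl_summable T f)⟩ : Hilb (J × K))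
      map_add' := fun f g => by
        apply lp.ext; funext p
        exact congrFun (congrArg (fun h : Hilb J => (h : J → ℂ))
          (T.map_add (slice f p.2) (slice g p.2))) p.1
      map_smul' := fun c f => by
        apply lp.ext; funext p
        exact congrFun (congrArg (fun h : Hilb J => (h : J → ℂ))
          (T.map_smul c (slice f p.2))) p.1 }
    ‖T‖ (fun f => by
      refine (pow_le_pow_iff_left₀ (norm_nonneg _) (by positivity) two_ne_zero).1 ?_
      have h := (slice_hasSum f).mul_left (‖T‖ ^ 2)
      rw [← mul_pow] at h
      refine hasSum_le (fun c => ?_) (slice_hasSum _) h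
      rw [← mul_pow]
      exact pow_le_pow_left₀ (norm_nonneg _) (T.le_opNorm (slice f c)) 2)

theorem ampl_apply {I J K : Type} (T : Op I J) (f : Hilb (I × K)) (p : J × K) :
    ampl K T f p = T (slice f p.2) p.1 := rfl

theorem ket_apply {I : Type} [DecidableEq I] (i j : I) :
    ket i j = if j = i then 1 else 0 := by
  by_cases h : j = i
  · subst h
    rw [if_pos rfl]
    exact @lp.single_apply_self I (fun _ => ℂ) _ (Classical.decEq I) 2 j 1
  · rw [if_neg h]
    exact @lp.single_apply_ne I (fun _ => ℂ) _ (Classical.decEq I) 2 i 1 j h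

theorem reindex_symm_ket {I J : Type} (e : I ≃ J) (j : J) :
    (reindex e).symm (ket j) = ket (e.symm j) := by
  classical
  apply lp.ext; funext i
  change ket j (e i) = _
  simp [ket_apply, Equiv.eq_symm_apply]

/-- Existence of the tensor product of two bounded operators. -/
theorem exists_tensorOp_prod {I J K L : Type} (T : Op I J) (S : Op K L) :
    ∃ R : Op (I × K) (J × L), ∀ i j, R (ket i) j = T (ket i.1) j.1 * S (ket i.2) j.2 := by
  classical
  refine ⟨((reindex (Equiv.prodComm L J)).toContinuousLinearEquiv : Op (L × J) (J × L)) ∘L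
    ampl J S ∘L ((reindex (Equiv.prodComm J K)).toContinuousLinearEquiv : Op (J × K) (K × J)) ∘L
    ampl K T, fun i j => ?_⟩
  have h1 : ∀ c, slice (ket i) c = if c = i.2 then ket i.1 else 0 := fun c => by
    apply lp.ext; funext a
    change ket i (a, c) = _
    obtain ⟨i1, i2⟩ := i
    by_cases h : c = i2 <;> simp [ket_apply, h]
  have h2 : slice (reindex (Equiv.prodComm J K) (ampl K T (ket i))) j.1
      = (T (ket i.1) j.1) • ket i.2 := by
    apply lp.ext; funext c
    change T (slice (ket i) c) j.1 = T (ket i.1) j.1 * ket i.2 c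
    rw [h1]
    by_cases h : c = i.2 <;> simp [ket_apply, h]
  change S (slice (reindex (Equiv.prodComm J K) (ampl K T (ket i))) j.1) j.2 = _
  rw [h2, map_smul]
  rfl

/-- Existence of the tensor product of a finite family of bounded operators. -/
theorem exists_tensorOp {ι : Type} [Fintype ι] (I J : ι → Type) (T : ∀ k, Op (I k) (J k)) :
    ∃ S : Op (∀ k, I k) (∀ k, J k), ∀ i j, S (ket i) j = ∏ k, T k (ket (i k)) (j k) := by
  classical
  revert I J T
  refine Fintype.induction_empty_option
    (P := fun (ι : Type) [Fintype ι] => ∀ (I J : ι → Type) (T : ∀ k, Op (I k) (J k)),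
      ∃ S : Op (∀ k, I k) (∀ k, J k), ∀ i j, S (ket i) j = ∏ k, T k (ket (i k)) (j k))
    ?_ ?_ ?_ ι
  · intro α β _ e ih I J T
    let _ := Fintype.ofEquiv β e.symm
    obtain ⟨S, hS⟩ := ih (fun a => I (e a)) (fun a => J (e a)) (fun a => T (e a))
    refine ⟨((reindex (Equiv.piCongrLeft J e)).toContinuousLinearEquiv : Op _ _) ∘L S ∘L
      ((reindex (Equiv.piCongrLeft I e)).symm.toContinuousLinearEquiv : Op _ _), fun i j => ?_⟩
    change S ((reindex (Equiv.piCongrLeft I e)).symm (ket i)) ((Equiv.piCongrLeft J e).symm j) = _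
    rw [reindex_symm_ket, hS]
    exact Equiv.prod_comp e (fun b => T b (ket (i b)) (j b))
  · intro I J T
    refine ⟨((reindex (Equiv.ofUnique (∀ k, I k) (∀ k, J k))).toContinuousLinearEquiv : Op _ _),
      fun i j => ?_⟩
    change ket i ((Equiv.ofUnique (∀ k, I k) (∀ k, J k)).symm j) = _
    simp [ket_apply, eq_iff_true_of_subsingleton]
  · intro α _ ih I J T
    obtain ⟨S, hS⟩ := ih (fun a => I (some a)) (fun a => J (some a)) (fun a => T (some a))
    obtain ⟨R, hR⟩ := exists_tensorOp_prod (T none) S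
    refine ⟨((reindex (Equiv.piOptionEquivProd (β := J))).symm.toContinuousLinearEquiv : Op _ _) ∘L
      R ∘L ((reindex (Equiv.piOptionEquivProd (β := I))).toContinuousLinearEquiv : Op _ _),
      fun i j => ?_⟩
    have h : reindex (Equiv.piOptionEquivProd (β := I)) (ket i)
        = ket (Equiv.piOptionEquivProd (β := I) i) := by
      rw [LinearIsometryEquiv.eq_symm_apply .. |>.symm, reindex_symm_ket, Equiv.symm_apply_apply]
    change R (reindex (Equiv.piOptionEquivProd (β := I)) (ket i))
      (Equiv.piOptionEquivProd (β := J) j) = _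
    rw [h, hR, Fintype.prod_option, hS]
    rfl

/-- The operator `⨂ₖ T k` on `⨂ₖ ℓ²(I k) = ℓ²(∀ k, I k)`. -/
noncomputable def tensorOp {ι : Type} [Fintype ι] {I J : ι → Type} (T : ∀ k, Op (I k) (J k)) :
    Op (∀ k, I k) (∀ k, J k) :=
  Classical.choose (exists_tensorOp I J T)

theorem tensorOp_ket {ι : Type} [Fintype ι] {I J : ι → Type} (T : ∀ k, Op (I k) (J k))
    (i : ∀ k, I k) (j : ∀ k, J k) : tensorOp T (ket i) j = ∏ k, T k (ket (i k)) (j k) :=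
  Classical.choose_spec (exists_tensorOp I J T) i j

/-- The product vector `⨂ₖ x k` (in finite dimension). -/
noncomputable def prodVec {ι : Type} [Fintype ι] {d : ι → ℕ} (x : ∀ k, Hilb (Fin (d k))) :
    Hilb (∀ k, Fin (d k)) :=
  ⟨fun i => ∏ k, x k (i k), Memℓp.all _⟩

/-- The operator `T` acting on the tensor factor `k`. -/
noncomputable def localOp {ι : Type} [Fintype ι] [DecidableEq ι] {I : ι → Type} (k : ι)
    (T : Op (I k) (I k)) : Op (∀ k, I k) (∀ k, I k) :=
  tensorOp (Function.update (fun j => (1 : Op (I j) (I j))) k T)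

/-! ### Measurements, Bell functionals, connectors -/

/-- The label set of a leg: a finite number of settings, each with a finite number of outcomes. -/
structure Leg where
  settings : ℕ
  outcomes : Fin settings → ℕ

/-- The pairs `a|x`, as `⟨x, a⟩`. -/
abbrev Leg.Event (l : Leg) : Type := Σ x : Fin l.settings, Fin (l.outcomes x)

/-- A family of operators `A_{a|x}` on `ℓ²(I)`. -/
abbrev OpSystem (l : Leg) (I : Type) : Type := l.Event → Op I I

/-- `A` is a system of measurement operators: `(A_{a|x})ₐ` is a POVM for all `x`. -/
def IsPOVM {l : Leg} {I : Type} (A : OpSystem l I) : Prop :=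
  (∀ e, (A e).IsPositive) ∧ ∀ x, ∑ a, A ⟨x, a⟩ = 1

/-- `A` is a system of projective measurements. -/
def IsProjective {l : Leg} {I : Type} (A : OpSystem l I) : Prop :=
  IsPOVM A ∧ ∀ e, A e * A e = A e

section Multipartite

variable {ι : Type} [Fintype ι] [DecidableEq ι] {L : ι → Leg}

/-- A Bell functional `B^{a₁,…,a_q|x₁,…,x_q}`. -/
abbrev BellFunctional (L : ι → Leg) : Type := (∀ k, (L k).Event) → ℝ

/-- The Bell operator `B[A] = ∑_{a,x} B^{a|x} ⨂ₖ A⁽ᵏ⁾_{aₖ|xₖ}`. -/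
noncomputable def bellOp (B : BellFunctional L) {I : ι → Type} (A : ∀ k, OpSystem (L k) (I k)) :
    Op (∀ k, I k) (∀ k, I k) :=
  ∑ e : ∀ k, (L k).Event, (B e : ℂ) • tensorOp fun k => A k (e k)

/-- The set of values `⟨ψ|B[A]|ψ⟩` over all quantum realizations `(ψ, A)`. -/
def quantumValues (B : BellFunctional L) : Set ℝ :=
  {v | ∃ (I : ι → Type) (A : ∀ k, OpSystem (L k) (I k)) (ψ : Hilb (∀ k, I k)),
    (∀ k, IsPOVM (A k)) ∧ ‖ψ‖ = 1 ∧ v = (inner ℂ ψ (bellOp B A ψ)).re}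

/-- A normalized quantum Bell inequality: the maximal quantum value is `1`. -/
def IsNormalized (B : BellFunctional L) : Prop := IsGreatest (quantumValues B) 1

/-- The operators `f[A]`, for `f` a tensor polynomial: sums of products of the operators
`𝟙 ⊗ … ⊗ A⁽ᵏ⁾_{a|x} ⊗ … ⊗ 𝟙`. -/
noncomputable def tensorPolynomials {I : ι → Type} (A : ∀ k, OpSystem (L k) (I k)) :
    Subalgebra ℂ (Op (∀ k, I k) (∀ k, I k)) :=
  Algebra.adjoin ℂ {T | ∃ k e, T = localOp k (A k e)}

/-- The normalized Bell functional `B` fully self-tests the state `ψ'` and the measurements `A'`.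
The isometry of party `k` is `U k : H'ₖ → Hₖ ⊗ Kₖ` with `Hₖ ⊗ Kₖ = ℓ²(Fin (d k) × K k)`; a vector of
`⨂ₖ (Hₖ ⊗ Kₖ)` is a function of the tuples `f` of pairs, and `(φ ⊗ junk) f` is the product of the
coefficient of `φ ∈ ⨂ₖ Hₖ` at the first components and that of `junk ∈ ⨂ₖ Kₖ` at the second. -/
structure FullySelfTests {d : ι → ℕ} (B : BellFunctional L)
    (A' : ∀ k, OpSystem (L k) (Fin (d k))) (ψ' : Hilb (∀ k, Fin (d k))) : Prop where
  projective : ∀ k, IsProjective (A' k)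
  norm_state : ‖ψ'‖ = 1
  cyclic : {v | ∃ f ∈ tensorPolynomials A', v = f ψ'} = Set.univ
  normalized : IsNormalized B
  self_test : ∀ (I : ι → Type) (A : ∀ k, OpSystem (L k) (I k)) (ψ : Hilb (∀ k, I k)),
    (∀ k, IsPOVM (A k)) → ‖ψ‖ = 1 → (inner ℂ ψ (bellOp B A ψ)).re = 1 →
    ∃ (b : ∀ k, OrthonormalBasis (Fin (d k)) ℂ (Hilb (Fin (d k))))
      (Ψ : (∀ k, Fin (d k)) → Hilb (∀ k, I k)),
      Orthonormal ℂ Ψ ∧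
      ψ = ∑ i, (inner ℂ (prodVec fun k => b k (i k)) ψ') • Ψ i ∧
      ∃ (K : ι → Type) (junk : Hilb (∀ k, K k))
        (U : ∀ k, Hilb (I k) →ₗᵢ[ℂ] Hilb (Fin (d k) × K k)),
        ‖junk‖ = 1 ∧
        ∀ (e : ∀ k, (L k).Event) (i : ∀ k, Fin (d k)) (f : ∀ k, Fin (d k) × K k),
          tensorOp (fun k => (U k).toContinuousLinearMap) (tensorOp (fun k => A k (e k)) (Ψ i)) f
            = tensorOp (fun k => A' k (e k)) (prodVec fun k => b k (i k)) (fun k => (f k).1)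
              * junk (fun k => (f k).2)

/-- The tensor of a `q → 1` connector: `C_{b|y}^{a₁,…,a_q|x₁,…,x_q}`. -/
abbrev ConnTensor (L : ι → Leg) (out : Leg) : Type := out.Event → BellFunctional L

/-- The operators `C[A] = {C_{b|y}[A]}`. -/
noncomputable def connOp {out : Leg} (C : ConnTensor L out) {I : ι → Type}
    (A : ∀ k, OpSystem (L k) (I k)) : OpSystem out (∀ k, I k) :=
  fun o => bellOp (C o) A

/-- `C` is a normalized quantum connector: it maps every `q`-partite system of POVMs to a
one-partite system of POVMs. Equivalently, contracting `q` legs of a quantum behaviour with `C`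
always yields a (normalized) quantum behaviour. -/
def IsConnector {out : Leg} (C : ConnTensor L out) : Prop :=
  ∀ (I : ι → Type) (A : ∀ k, OpSystem (L k) (I k)), (∀ k, IsPOVM (A k)) → IsPOVM (connOp C A)

end Multipartite

/-! ### Connector complexes and congruent contractions -/

/-- The label set of a leg together with the dimension of the Hilbert space attached to it. -/
structure Party extends Leg where
  dim : ℕ

/-- The data `(C, A, V)` of a connector complex with output leg (and output space) `out`; its input
legs are indexed by the finite type `ι`. -/
structure ConnectorData (out : Party) where
  ι : Type
  [fintype : Fintype ι]
  [decEq : DecidableEq ι]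
  party : ι → Party
  C : ConnTensor (fun k => (party k).toLeg) out.toLeg
  A : ∀ k, OpSystem (party k).toLeg (Fin (party k).dim)
  V : Op (∀ k, Fin (party k).dim) (Fin out.dim)

attribute [instance] ConnectorData.fintype ConnectorData.decEq

namespace ConnectorData

variable {out : Party}

/-- The space `⨂ₖ Hₖ`. -/
abbrev Space (X : ConnectorData out) : Type := Hilb (∀ k, Fin (X.party k).dim)

/-- `M_{b|y} = V C_{b|y}[A] V†`. -/
noncomputable def M (X : ConnectorData out) : OpSystem out.toLeg (Fin out.dim) :=
  fun o => X.V ∘L connOp X.C X.A o ∘L ContinuousLinearMap.adjoint X.V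

/-- `(C, A, V)` is a connector complex. -/
structure IsConnectorComplex (X : ConnectorData out) : Prop where
  connector : IsConnector X.C
  povm : ∀ k, IsPOVM (X.A k)
  coisometry : X.V ∘L ContinuousLinearMap.adjoint X.V = 1
  projective : IsProjective X.M

/-- The invariant subspace, the range of `V†`. -/
noncomputable def invariantSubspace (X : ConnectorData out) : Submodule ℂ X.Space :=
  LinearMap.range (ContinuousLinearMap.adjoint X.V).toLinearMap

/-- The Bell functional `∑_{b,y} μ_{b|y} C_{b|y}`. -/
def bell (X : ConnectorData out) (μ : out.Event → ℝ) :
    BellFunctional (fun k => (X.party k).toLeg) :=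
  fun e => ∑ o, μ o * X.C o e

/-- The connector complex is fully self-testing, with coefficients `μ` and state `ψ`. -/
structure IsFullySelfTesting (X : ConnectorData out) (μ : out.Event → ℝ) (ψ : X.Space) : Prop where
  self_tests : FullySelfTests (X.bell μ) X.A ψ
  mem_invariant : ψ ∈ X.invariantSubspace
  cyclic : (X.invariantSubspace : Set X.Space)
    = {v | ∃ f ∈ Algebra.adjoin ℂ (Set.range (connOp X.C X.A)), v = f ψ}

section Contraction

variable (X₂ : ConnectorData out) (k : X₂.ι) (X₁ : ConnectorData (X₂.party k))

/-- The input legs after the output leg of `X₁` has been plugged into the leg `k` of `X₂`. -/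
abbrev contractParty : X₁.ι ⊕ {j : X₂.ι // j ≠ k} → Party :=
  Sum.elim X₁.party (fun j => X₂.party j)

/-- `𝟙 ⊗ V(X₁) ⊗ 𝟙`, with `V(X₁)` producing the tensor factor `k` of the space of `X₂`. -/
noncomputable def plug :
    Op (∀ j, Fin (contractParty X₂ k X₁ j).dim) (∀ j, Fin (X₂.party j).dim) :=
  reindexOp (Equiv.piSplitAt k (fun j => Fin (X₂.party j).dim)).symm ∘L
    ampl (∀ j : {j : X₂.ι // j ≠ k}, Fin (X₂.party j).dim) X₁.V ∘L
    reindexOp (Equiv.sumPiEquivProdPi (fun j => Fin (contractParty X₂ k X₁ j).dim))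

/-- The contraction of the output leg of `X₁` with the leg `k` of `X₂`. -/
noncomputable def contract : ConnectorData out where
  ι := X₁.ι ⊕ {j : X₂.ι // j ≠ k}
  party := contractParty X₂ k X₁
  C o e := ∑ c : (X₂.party k).Event,
    X₂.C o ((Equiv.piSplitAt k (fun j => (X₂.party j).Event)).symm (c, fun j => e (Sum.inr j)))
      * X₁.C c (fun l => e (Sum.inl l))
  A j := match j with
    | Sum.inl l => X₁.A l
    | Sum.inr j => X₂.A j
  V := X₂.V ∘L plug X₂ k X₁

/-- The state `(𝟙 ⊗ V(X₁)† ⊗ 𝟙) ψ` of the contraction, for a state `ψ` of `X₂`. -/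
noncomputable def contractState (ψ : X₂.Space) : (contract X₂ k X₁).Space :=
  ContinuousLinearMap.adjoint (plug X₂ k X₁) ψ

end Contraction

/-- `IsCongruentContraction n X μ ψ`: the tuple `X` results from congruently contracting, in a tree,
`n` fully self-testing connector complexes; `μ` are the coefficients of the complex at the root and
`ψ` is the tensor network state obtained by applying to the state of the root complex the adjoint
coisometries of all the others. A contraction is congruent if `M(X₁) = A⁽ᵏ⁾(X₂)`. -/
inductive IsCongruentContraction : {out : Party} → ℕ → (X : ConnectorData out) →
    (out.Event → ℝ) → X.Space → Prop
  | single {out : Party} (X : ConnectorData out) (μ : out.Event → ℝ) (ψ : X.Space)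
      (hX : X.IsConnectorComplex) (hψ : X.IsFullySelfTesting μ ψ) :
      IsCongruentContraction 1 X μ ψ
  | contract {out : Party} {n₁ n₂ : ℕ} (X₂ : ConnectorData out) (μ₂ : out.Event → ℝ) (ψ₂ : X₂.Space)
      (k : X₂.ι) (X₁ : ConnectorData (X₂.party k)) (μ₁ : (X₂.party k).Event → ℝ) (ψ₁ : X₁.Space)
      (h₁ : IsCongruentContraction n₁ X₁ μ₁ ψ₁) (h₂ : IsCongruentContraction n₂ X₂ μ₂ ψ₂)
      (congruent : X₁.M = X₂.A k) :
      IsCongruentContraction (n₁ + n₂) (contract X₂ k X₁) μ₂ (contractState X₂ k X₁ ψ₂)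

end ConnectorData

end TightConnectors

/-!
Summing over the outcomes of all parties but one, a full self-test provides for every optimal
realization an isometry from the reference space to the realizing one that intertwines all local
measurement operators and maps the reference state to the given state. The reference measurements
of each party moreover have trivial commutant, so they generate the full matrix algebra. Conversely
these two properties imply full self-testing: the intertwiner lifts the matrix units of each party
to local operators, which form the columns of the local isometries.

Let the complex `X₁` be plugged into the leg `k` of `X₂`, and take an optimal realization of the
contraction. The connector of `X₁` turns the measurements of its parties into measurements on the
leg `k`, so the self-test of `X₂` yields an intertwiner `W₂` defined on the output space of `X₁`
tensored with the other parties. For each basis vector `ρ` of the latter, `W₂ (χ ⊗ ρ)`, where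
`V(X₁)† χ` is the state of `X₁`, is optimal for `X₁` in the presence of a further system, so
`W₂ (· ⊗ ρ)` extends along `V(X₁)†` to an intertwiner of the measurements of `X₁`. By
irreducibility the Gram matrix of these extensions is scalar in each entry, hence equal to the
identity, and they assemble to the intertwiner required for the contraction.
-/

open scoped ComplexConjugate InnerProduct

namespace TightConnectors

/-! ### Intertwiners and cyclic subspaces -/

section Intertwiners

variable {𝕜 E F G α β : Type*} [NontriviallyNormedField 𝕜]
  [NormedAddCommGroup E] [NormedSpace 𝕜 E] [NormedAddCommGroup F] [NormedSpace 𝕜 F]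
  [NormedAddCommGroup G] [NormedSpace 𝕜 G]

/-- The operator `W` intertwines the families of operators `T` and `S`. -/
def Intertwines (S : α → F →L[𝕜] F) (T : α → E →L[𝕜] E) (W : E →L[𝕜] F) : Prop :=
  ∀ a, S a ∘L W = W ∘L T a

variable {R : α → G →L[𝕜] G} {S : α → F →L[𝕜] F} {T : α → E →L[𝕜] E} {W W' : E →L[𝕜] F}

theorem Intertwines.apply (h : Intertwines S T W) (a : α) (v : E) : S a (W v) = W (T a v) :=
  DFunLike.congr_fun (h a) v

theorem Intertwines.comp {X : F →L[𝕜] G} (hX : Intertwines R S X) (hW : Intertwines S T W) :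
    Intertwines R T (X ∘L W) := fun a => by
  rw [← ContinuousLinearMap.comp_assoc, hX a, ContinuousLinearMap.comp_assoc, hW a,
    ContinuousLinearMap.comp_assoc]

theorem Intertwines.symm {e : E ≃L[𝕜] F} (h : Intertwines S T (e : E →L[𝕜] F)) :
    Intertwines T S (e.symm : F →L[𝕜] E) := fun a => ContinuousLinearMap.ext fun v => by
  obtain ⟨v, rfl⟩ := e.surjective v
  change T a (e.symm (e v)) = e.symm (S a (e v))
  rw [e.symm_apply_apply, show S a (e v) = e (T a v) from h.apply a v, e.symm_apply_apply]

theorem Intertwines.smul (c : 𝕜) (h : Intertwines S T W) : Intertwines S T (c • W) := fun a => by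
  rw [ContinuousLinearMap.comp_smul, h a, ContinuousLinearMap.smul_comp]

theorem Intertwines.sub (h : Intertwines S T W) (h' : Intertwines S T W') :
    Intertwines S T (W - W') := fun a => by
  rw [ContinuousLinearMap.comp_sub, h a, h' a, ContinuousLinearMap.sub_comp]

/-- The space of the vectors `f ψ`, for `f` a polynomial in the operators `T`. -/
noncomputable def cyclicSubspace (T : α → E →L[𝕜] E) (ψ : E) : Submodule 𝕜 E :=
  (Algebra.adjoin 𝕜 (Set.range T)).toSubmodule.map
    (ContinuousLinearMap.apply 𝕜 E ψ).toLinearMap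

theorem coe_cyclicSubspace (T : α → E →L[𝕜] E) (ψ : E) :
    (cyclicSubspace T ψ : Set E) = {v | ∃ f ∈ Algebra.adjoin 𝕜 (Set.range T), v = f ψ} := by
  ext v
  simp [cyclicSubspace, eq_comm]

theorem mem_cyclicSubspace_self (T : α → E →L[𝕜] E) (ψ : E) : ψ ∈ cyclicSubspace T ψ :=
  ⟨1, one_mem (Algebra.adjoin 𝕜 (Set.range T)), rfl⟩

theorem map_mem_cyclicSubspace (T : α → E →L[𝕜] E) {ψ v : E} (hv : v ∈ cyclicSubspace T ψ)
    (a : α) : T a v ∈ cyclicSubspace T ψ := by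
  obtain ⟨f, hf, rfl⟩ := hv
  exact ⟨T a * f, (Algebra.adjoin 𝕜 (Set.range T)).mul_mem (Algebra.subset_adjoin ⟨a, rfl⟩) hf, rfl⟩

theorem cyclicSubspace_le {ψ : E} {p : Submodule 𝕜 E} (hψ : ψ ∈ p)
    (hp : ∀ a, ∀ v ∈ p, T a v ∈ p) : cyclicSubspace T ψ ≤ p := by
  rintro _ ⟨f, hf, rfl⟩
  change f ψ ∈ p
  induction hf using Algebra.adjoin_induction generalizing ψ with
  | mem _ hf => obtain ⟨a, rfl⟩ := hf; exact hp a ψ hψ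
  | algebraMap c => exact p.smul_mem c hψ
  | add _ _ _ _ hf hg => exact p.add_mem (hf hψ) (hg hψ)
  | mul _ _ _ _ hf hg => exact hf (hg hψ)

theorem cyclicSubspace_comp {g : β → α} (hg : Function.Surjective g) (T : α → E →L[𝕜] E) (ψ : E) :
    cyclicSubspace (T ∘ g) ψ = cyclicSubspace T ψ := by
  rw [cyclicSubspace, hg.range_comp, cyclicSubspace]

theorem Intertwines.map_cyclicSubspace (h : Intertwines S T W) (ψ : E) :
    (cyclicSubspace T ψ).map W.toLinearMap = cyclicSubspace S (W ψ) := by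
  refine le_antisymm ?_ (cyclicSubspace_le ⟨ψ, mem_cyclicSubspace_self T ψ, rfl⟩ ?_)
  · refine Submodule.map_le_iff_le_comap.2 (cyclicSubspace_le (mem_cyclicSubspace_self S _) ?_)
    intro a v hv
    have := map_mem_cyclicSubspace S (Submodule.mem_comap.1 hv) a
    exact Submodule.mem_comap.2 (h.apply a v ▸ this)
  · rintro a _ ⟨v, hv, rfl⟩
    exact ⟨T a v, map_mem_cyclicSubspace T hv a, (h.apply a v).symm⟩

theorem Intertwines.eqOn_cyclicSubspace (h : Intertwines S T W) (h' : Intertwines S T W') {ψ : E}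
    (hψ : W ψ = W' ψ) : Set.EqOn W W' (cyclicSubspace T ψ) := by
  have hle : cyclicSubspace T ψ ≤ (W - W').toLinearMap.ker := by
    refine cyclicSubspace_le (sub_eq_zero.2 hψ) fun a v hv => ?_
    change (W - W') (T a v) = 0
    rw [← (h.sub h').apply, show (W - W') v = 0 from hv, map_zero]
  exact fun v hv => sub_eq_zero.1 (hle hv)

end Intertwiners

/-! ### Operators on Hilbert spaces -/

section Hilbert

variable {𝕜 E F α : Type*} [RCLike 𝕜]
  [NormedAddCommGroup E] [InnerProductSpace 𝕜 E] [NormedAddCommGroup F] [InnerProductSpace 𝕜 F]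

theorem Intertwines.adjoint [CompleteSpace E] [CompleteSpace F] {S : α → F →L[𝕜] F}
    {T : α → E →L[𝕜] E} {W : E →L[𝕜] F} (h : Intertwines S T W) (hS : ∀ a, IsSelfAdjoint (S a))
    (hT : ∀ a, IsSelfAdjoint (T a)) : Intertwines T S (W†) := fun a => by
  have := congrArg ContinuousLinearMap.adjoint (h a)
  rwa [ContinuousLinearMap.adjoint_comp, ContinuousLinearMap.adjoint_comp, (hS a).adjoint_eq,
    (hT a).adjoint_eq, eq_comm] at this

theorem exists_linearIsometry_eqOn (p : Submodule 𝕜 E) [p.HasOrthogonalProjection] (Q : E →L[𝕜] F)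
    (J : E →ₗᵢ[𝕜] F) (hQ : ∀ v ∈ p, ‖Q v‖ = ‖v‖) (hQJ : ∀ v w, inner 𝕜 (Q v) (J w) = 0) :
    ∃ U : E →ₗᵢ[𝕜] F, Set.EqOn U Q p := by
  let T : E →ₗ[𝕜] F := Q.toLinearMap ∘ₗ p.starProjection.toLinearMap
    + J.toLinearMap ∘ₗ pᗮ.starProjection.toLinearMap
  refine ⟨⟨T, fun v => ?_⟩, fun v hv => ?_⟩
  · refine (pow_left_inj₀ (norm_nonneg _) (norm_nonneg _) two_ne_zero).1 ?_
    change ‖Q (p.starProjection v) + J (pᗮ.starProjection v)‖ ^ 2 = _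
    rw [sq, norm_add_sq_eq_norm_sq_add_norm_sq_of_inner_eq_zero _ _ (hQJ _ _),
      hQ _ (p.starProjection_apply_mem v), J.norm_map, ← sq, ← sq,
      p.norm_sq_eq_add_norm_sq_starProjection v]
  · change Q (p.starProjection v) + J (pᗮ.starProjection v) = Q v
    rw [Submodule.starProjection_eq_self_iff.2 hv, Submodule.starProjection_orthogonal_val]
    simp [Submodule.starProjection_eq_self_iff.2 hv]

theorem isSemisimpleModule_starSubalgebra [FiniteDimensional 𝕜 E] [CompleteSpace E]
    (R : StarSubalgebra 𝕜 (E →L[𝕜] E)) : IsSemisimpleModule R.toSubalgebra E := by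
  refine (isSemisimpleModule_iff _ _).2 ⟨fun p => ?_⟩
  have : IsScalarTower 𝕜 R.toSubalgebra E := ⟨fun _ _ _ => rfl⟩
  let p' : Submodule 𝕜 E := p.restrictScalars 𝕜
  let q : Submodule R.toSubalgebra E :=
    { p'ᗮ with
      smul_mem' := fun r v hv => by
        refine (Submodule.mem_orthogonal p' _).2 fun u hu => ?_
        change inner 𝕜 u ((r : E →L[𝕜] E) v) = 0
        rw [← ContinuousLinearMap.adjoint_inner_left]
        exact hv _ (p.smul_mem ⟨_, R.star_mem' r.2⟩ hu) }
  refine ⟨q, Submodule.disjoint_def.2 fun x hx hx' => ?_,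
    codisjoint_iff.2 (Submodule.eq_top_iff'.2 fun x => ?_)⟩
  · exact Submodule.disjoint_def.1 p'.orthogonal_disjoint x hx hx'
  · obtain ⟨y, hy, z, hz, rfl⟩ := p'.exists_add_mem_mem_orthogonal x
    exact Submodule.mem_sup.2 ⟨y, hy, z, hz, rfl⟩

end Hilbert

section ComplexHilbert

variable {E F α : Type*} [NormedAddCommGroup E] [InnerProductSpace ℂ E] [CompleteSpace E]
  [NormedAddCommGroup F] [InnerProductSpace ℂ F] [CompleteSpace F]

theorem apply_eq_zero_of_isPositive {D : E →L[ℂ] E} (hD : D.IsPositive) {v : E}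
    (hv : (inner ℂ v (D v)).re = 0) : D v = 0 := by
  obtain ⟨S, rfl⟩ := CStarAlgebra.nonneg_iff_eq_star_mul_self.1
    ((ContinuousLinearMap.nonneg_iff_isPositive D).2 hD)
  change (inner ℂ v ((S†) (S v))).re = 0 at hv
  rw [ContinuousLinearMap.adjoint_inner_right, ← RCLike.re_to_complex,
    inner_self_eq_norm_sq (𝕜 := ℂ), sq_eq_zero_iff, norm_eq_zero] at hv
  change (S†) (S v) = 0
  rw [hv, map_zero]

theorem apply_eq_self_of_re_inner_eq {T : E →L[ℂ] E} (hT : IsSelfAdjoint T)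
    (hle : ∀ v, (inner ℂ v (T v)).re ≤ ‖v‖ ^ 2) {v : E} (hv : (inner ℂ v (T v)).re = ‖v‖ ^ 2) :
    T v = v := by
  have hre : ∀ w, (inner ℂ w ((1 - T) w)).re = ‖w‖ ^ 2 - (inner ℂ w (T w)).re := fun w => by
    change (inner ℂ w (w - T w)).re = _
    rw [inner_sub_right, Complex.sub_re, ← RCLike.re_to_complex, inner_self_eq_norm_sq (𝕜 := ℂ)]
  have hpos : (1 - T).IsPositive :=
    ContinuousLinearMap.isPositive_def'.2 ⟨(IsSelfAdjoint.one _).sub hT, fun w => by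
      rw [ContinuousLinearMap.reApplyInnerSelf, inner_re_symm, RCLike.re_to_complex, hre]
      exact sub_nonneg.2 (hle w)⟩
  have : (1 - T) v = 0 := apply_eq_zero_of_isPositive hpos (by rw [hre, hv, sub_self])
  exact (sub_eq_zero.1 this).symm

/-- By the density theorem, since the generated `⋆`-algebra acts semisimply. -/
theorem adjoin_range_eq_top_of_commutant [FiniteDimensional ℂ E] {T : α → E →L[ℂ] E}
    (hT : ∀ a, IsSelfAdjoint (T a)) (hc : ∀ Z, Intertwines T T Z → ∃ z : ℂ, Z = z • 1) :
    Algebra.adjoin ℂ (Set.range T) = ⊤ := by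
  have hstar : (StarAlgebra.adjoin ℂ (Set.range T)).toSubalgebra
      = Algebra.adjoin ℂ (Set.range T) := by
    rw [StarAlgebra.adjoin_toSubalgebra, Set.union_eq_left.2]
    rintro f ⟨a, ha⟩
    exact ⟨a, by rw [← (hT a).star_eq, ha, star_star]⟩
  set R := Algebra.adjoin ℂ (Set.range T)
  have : IsSemisimpleModule R E := hstar ▸ isSemisimpleModule_starSubalgebra _
  have : IsScalarTower ℂ R E := ⟨fun _ _ _ => rfl⟩
  have hscalar : ∀ g : Module.End R E, ∃ z : ℂ, ∀ v, g v = z • v := fun g => by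
    obtain ⟨z, hz⟩ := hc (g.restrictScalars ℂ).toContinuousLinearMap fun a =>
      ContinuousLinearMap.ext fun v =>
        (map_smul g (⟨T a, Algebra.subset_adjoin ⟨a, rfl⟩⟩ : R) v).symm
    exact ⟨z, fun v => DFunLike.congr_fun hz v⟩
  refine Algebra.eq_top_iff.2 fun X => ?_
  let f : Module.End (Module.End R E) E :=
    { X.toLinearMap.toAddMonoidHom with
      map_smul' := fun g v => by
        obtain ⟨z, hz⟩ := hscalar g
        change X (g v) = g (X v)
        rw [hz, hz, map_smul] }
  obtain ⟨s, hs⟩ := Module.finite_def.1 (inferInstance : Module.Finite ℂ E)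
  obtain ⟨r, hr⟩ := jacobson_density f s
  have : X = r := ContinuousLinearMap.coe_injective (LinearMap.ext_on hs hr)
  exact this ▸ r.2

theorem exists_intertwined_of_mem_adjoin {A B : Type*} [Ring A] [StarRing A] [Algebra ℂ A]
    [StarModule ℂ A] [Ring B] [StarRing B] [Algebra ℂ B] [StarModule ℂ B]
    (φ : A →⋆ₐ[ℂ] (E →L[ℂ] E)) (χ : B →⋆ₐ[ℂ] (F →L[ℂ] F)) {a : α → A} {b : α → B}
    (ha : ∀ i, IsSelfAdjoint (a i)) (hb : ∀ i, IsSelfAdjoint (b i)) {W : E →L[ℂ] F}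
    (hW : Intertwines (χ ∘ b) (φ ∘ a) W) {x : A} (hx : x ∈ Algebra.adjoin ℂ (Set.range a)) :
    ∃ y, χ y ∘L W = W ∘L φ x ∧ χ (star y) ∘L W = W ∘L φ (star x) := by
  have hmul : ∀ {x x' y y'}, χ y ∘L W = W ∘L φ x → χ y' ∘L W = W ∘L φ x' →
      χ (y * y') ∘L W = W ∘L φ (x * x') := fun {x x' y y'} h h' => by
    rw [map_mul, map_mul, ContinuousLinearMap.mul_def, ContinuousLinearMap.comp_assoc, h',
      ← ContinuousLinearMap.comp_assoc, h, ContinuousLinearMap.comp_assoc]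
    rfl
  have hadd : ∀ {x x' y y'}, χ y ∘L W = W ∘L φ x → χ y' ∘L W = W ∘L φ x' →
      χ (y + y') ∘L W = W ∘L φ (x + x') := fun {x x' y y'} h h' => by
    rw [map_add, map_add, ContinuousLinearMap.add_comp, h, h', ContinuousLinearMap.comp_add]
  have hscalar : ∀ c : ℂ, χ (algebraMap ℂ B c) ∘L W = W ∘L φ (algebraMap ℂ A c) := fun c => by
    ext1 v
    simp [Algebra.algebraMap_eq_smul_one]
  induction hx using Algebra.adjoin_induction with
  | mem x hx =>
    obtain ⟨i, rfl⟩ := hx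
    exact ⟨b i, hW i, by rw [(ha i).star_eq, (hb i).star_eq]; exact hW i⟩
  | algebraMap c =>
    exact ⟨algebraMap ℂ B c, hscalar c, by
      rw [← algebraMap_star_comm, ← algebraMap_star_comm]; exact hscalar _⟩
  | add x x' _ _ h h' =>
    obtain ⟨⟨y, hy, hy_star⟩, ⟨y', hy', hy'_star⟩⟩ := And.intro h h'
    exact ⟨y + y', hadd hy hy', by rw [star_add, star_add]; exact hadd hy_star hy'_star⟩
  | mul x x' _ _ h h' =>
    obtain ⟨⟨y, hy, hy_star⟩, ⟨y', hy', hy'_star⟩⟩ := And.intro h h'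
    exact ⟨y * y', hmul hy hy', by rw [star_mul, star_mul]; exact hmul hy'_star hy_star⟩

end ComplexHilbert

/-! ### Matrix entries -/

section Entries

variable {I J K : Type}

theorem ket_self (i : I) : ket i i = 1 := by
  classical
  rw [ket_apply, if_pos rfl]

theorem ket_of_ne {i j : I} (h : j ≠ i) : ket i j = 0 := by
  classical
  rw [ket_apply, if_neg h]

theorem inner_ket_left (i : I) (f : Hilb I) : inner ℂ (ket i) f = f i := by
  classical
  convert lp.inner_single_left (𝕜 := ℂ) (G := fun _ : I => ℂ) i 1 f using 1
  · unfold ket; congr!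
  · simp

theorem orthonormal_ket : Orthonormal ℂ (ket : I → Hilb I) := by
  classical
  refine orthonormal_iff_ite.2 fun i j => ?_
  rw [inner_ket_left, ket_apply]

theorem hasSum_ket (f : Hilb I) : HasSum (fun i => f i • ket i) f := by
  classical
  convert lp.hasSum_single (E := fun _ : I => ℂ) (p := 2) (by norm_num) f using 1
  funext i
  refine lp.ext (funext fun j => ?_)
  change f i * ket i j = _
  obtain rfl | h := eq_or_ne j i
  · simp [ket_self]
  · simp [ket_of_ne h, h]

theorem sum_ket [Fintype I] (f : Hilb I) : ∑ i, f i • ket i = f :=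
  (hasSum_fintype _).unique (hasSum_ket f)

instance finiteDimensional_hilb [Finite I] : FiniteDimensional ℂ (Hilb I) := by
  cases nonempty_fintype I
  exact FiniteDimensional.of_injective
    { toFun := fun (f : Hilb I) i => f i
      map_add' := fun _ _ => rfl
      map_smul' := fun _ _ => rfl } fun _ _ h => lp.ext h

/-- The kets, as an orthonormal basis of a finite-dimensional space. -/
noncomputable def ketBasis (I : Type) [Fintype I] : OrthonormalBasis I ℂ (Hilb I) :=
  OrthonormalBasis.mk orthonormal_ket fun f _ => by
    rw [← sum_ket f]
    exact Submodule.sum_mem _ fun i _ => Submodule.smul_mem _ _ (Submodule.subset_span ⟨i, rfl⟩)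

theorem ketBasis_apply [Fintype I] (i : I) : ketBasis I i = ket i :=
  congrFun (OrthonormalBasis.coe_mk _ _) i

theorem nonempty_of_norm_eq_one {ψ : Hilb I} (h : ‖ψ‖ = 1) : Nonempty I := by
  by_contra hI
  rw [not_nonempty_iff] at hI
  rw [show ψ = 0 from lp.ext (funext hI.elim), norm_zero] at h
  exact zero_ne_one h

theorem map_ext_ket {F : Type*} [AddCommMonoid F] [Module ℂ F] [TopologicalSpace F] [T2Space F]
    {T S : Hilb I →L[ℂ] F} (h : ∀ i, T (ket i) = S (ket i)) : T = S := by
  ext1 f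
  have hT := (hasSum_ket f).mapL T
  have hS := (hasSum_ket f).mapL S
  simp only [map_smul, h] at hT hS
  exact hT.unique hS

theorem op_ext {T S : Op I J} (h : ∀ i j, T (ket i) j = S (ket i) j) : T = S :=
  map_ext_ket fun i => lp.ext (funext (h i))

theorem hasSum_op_apply (T : Op I J) (f : Hilb I) (j : J) :
    HasSum (fun i => f i * T (ket i) j) (T f j) := by
  have h := ((hasSum_ket f).mapL T).mapL (innerSL ℂ (ket j))
  simpa [inner_ket_left] using h

theorem adjoint_ket_apply (T : Op I J) (j : J) (i : I) : (T†) (ket j) i = conj (T (ket i) j) := by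
  rw [← inner_ket_left, ContinuousLinearMap.adjoint_inner_right, ← inner_conj_symm, inner_ket_left]

end Entries

/-! ### Products of series -/

theorem hasSum_mul_prod {α β : Type*} {f : α → ℂ} {g : β → ℂ} {a b : ℂ} (hf : HasSum f a)
    (hg : HasSum g b) : HasSum (fun p : α × β => f p.1 * g p.2) (a * b) :=
  hf.mul hg (summable_mul_of_summable_norm hf.summable.norm hg.summable.norm)

theorem hasSum_prod_pi {ι : Type} [Fintype ι] {I : ι → Type} {g : ∀ k, I k → ℂ} {a : ι → ℂ}
    (h : ∀ k, HasSum (g k) (a k)) :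
    HasSum (fun m : ∀ k, I k => ∏ k, g k (m k)) (∏ k, a k) := by
  suffices H : ∀ (ι : Type) [Finite ι] [Fintype ι] (I : ι → Type) (g : ∀ k, I k → ℂ) (a : ι → ℂ),
      (∀ k, HasSum (g k) (a k)) → HasSum (fun m : ∀ k, I k => ∏ k, g k (m k)) (∏ k, a k) from
    H ι I g a h
  clear h a g I
  intro ι _
  induction ι using Finite.induction_empty_option with
  | @of_equiv α β e ih =>
    intro _ I g a h
    let _ := Fintype.ofEquiv β e.symm
    rw [← Equiv.prod_comp e a, ← (Equiv.piCongrLeft I e).hasSum_iff]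
    convert ih _ _ _ fun x => h (e x) using 2 with m
    rw [Function.comp_apply, ← Equiv.prod_comp e]
    simp only [Equiv.piCongrLeft_apply_apply]
  | h_empty => intro _ I g a _; simp
  | @h_option α _ ih =>
    intro hα I g a h
    have := hasSum_mul_prod (h none) (ih _ _ _ fun x => h (some x))
    rw [← (Equiv.piOptionEquivProd (β := I)).hasSum_iff] at this
    obtain rfl := Subsingleton.elim instFintypeOption hα
    simp only [Fintype.prod_option]
    exact this

/-! ### Tensor products of operators -/

section TensorOp

variable {ι : Type} [Fintype ι] {I J K : ι → Type}

theorem tensorOp_comp (S : ∀ k, Op (J k) (K k)) (T : ∀ k, Op (I k) (J k)) :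
    tensorOp S ∘L tensorOp T = tensorOp fun k => S k ∘L T k := by
  refine op_ext fun i j => ?_
  rw [tensorOp_ket]
  refine (hasSum_op_apply (tensorOp S) (tensorOp T (ket i)) j).unique ?_
  simp only [tensorOp_ket, ← Finset.prod_mul_distrib]
  exact hasSum_prod_pi (g := fun k m => T k (ket (i k)) m * S k (ket m) (j k))
    fun k => hasSum_op_apply (S k) (T k (ket (i k))) (j k)

theorem tensorOp_adjoint (T : ∀ k, Op (I k) (J k)) :
    ContinuousLinearMap.adjoint (tensorOp T) = tensorOp fun k => (T k)† :=
  op_ext fun j i => by simp only [adjoint_ket_apply, tensorOp_ket, map_prod]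

theorem tensorOp_one : tensorOp (fun k => (1 : Op (I k) (I k))) = 1 := by
  classical
  refine op_ext fun i j => ?_
  rw [tensorOp_ket]
  simp only [one_apply_eq_self, ket_apply]
  rw [Finset.prod_ite_zero]
  simp [funext_iff]

theorem tensorOp_update_ket [DecidableEq ι] (T : ∀ k, Op (I k) (J k)) (k : ι) (S : Op (I k) (J k))
    (i : ∀ k, I k) (j : ∀ k, J k) : tensorOp (Function.update T k S) (ket i) j
      = S (ket (i k)) (j k) * ∏ l : {l // l ≠ k}, T l (ket (i l)) (j l) := by
  rw [tensorOp_ket, Fintype.prod_eq_mul_prod_subtype_ne _ k, Function.update_self]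
  congr 1
  exact Finset.prod_congr rfl fun l _ => by rw [Function.update_of_ne l.2]

/-- The tensor product of operators as a multilinear map. -/
noncomputable def tensorOpMultilinear (I J : ι → Type) :
    MultilinearMap ℂ (fun k => Op (I k) (J k)) (Op (∀ k, I k) (∀ k, J k)) where
  toFun := tensorOp
  map_update_add' T k x y := op_ext fun i j => by
    rw [add_apply, lp.coeFn_add, Pi.add_apply]
    simp only [tensorOp_update_ket, add_apply, lp.coeFn_add, Pi.add_apply, add_mul]
  map_update_smul' T k c x := op_ext fun i j => by
    rw [smul_apply, lp.coeFn_smul, Pi.smul_apply]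
    simp only [tensorOp_update_ket, smul_apply, lp.coeFn_smul, Pi.smul_apply, smul_mul_assoc]

theorem tensorOp_sum {α : ι → Type} [DecidableEq ι] (s : ∀ k, Finset (α k))
    (T : ∀ k, α k → Op (I k) (J k)) :
    tensorOp (fun k => ∑ a ∈ s k, T k a)
      = ∑ r ∈ Fintype.piFinset s, tensorOp fun k => T k (r k) := by
  classical exact (tensorOpMultilinear I J).map_sum_finset T s

end TensorOp

section Binary

variable {I J K L M N : Type}

/-- The tensor product of two operators. -/
noncomputable def tensorOpProd (T : Op I J) (S : Op K L) : Op (I × K) (J × L) :=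
  Classical.choose (exists_tensorOp_prod T S)

theorem tensorOpProd_ket (T : Op I J) (S : Op K L) (i : I × K) (j : J × L) :
    tensorOpProd T S (ket i) j = T (ket i.1) j.1 * S (ket i.2) j.2 :=
  Classical.choose_spec (exists_tensorOp_prod T S) i j

theorem tensorOpProd_comp (T : Op J M) (S : Op L N) (T' : Op I J) (S' : Op K L) :
    tensorOpProd T S ∘L tensorOpProd T' S' = tensorOpProd (T ∘L T') (S ∘L S') := by
  refine op_ext fun i j => ?_
  rw [tensorOpProd_ket]
  refine (hasSum_op_apply (tensorOpProd T S) (tensorOpProd T' S' (ket i)) j).unique ?_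
  refine (hasSum_mul_prod (hasSum_op_apply T (T' (ket i.1)) j.1)
    (hasSum_op_apply S (S' (ket i.2)) j.2)).congr_fun fun m => ?_
  rw [tensorOpProd_ket, tensorOpProd_ket, mul_mul_mul_comm]

theorem tensorOpProd_adjoint (T : Op I J) (S : Op K L) :
    ContinuousLinearMap.adjoint (tensorOpProd T S) = tensorOpProd (T†) (S†) :=
  op_ext fun j i => by simp only [adjoint_ket_apply, tensorOpProd_ket, map_mul]

theorem tensorOpProd_sum_left {α : Type*} (s : Finset α) (T : α → Op I J) (S : Op K L) :
    tensorOpProd (∑ a ∈ s, T a) S = ∑ a ∈ s, tensorOpProd (T a) S :=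
  let F : Op I J →+ Op (I × K) (J × L) := AddMonoidHom.mk' (fun T => tensorOpProd T S)
    fun T T' => op_ext fun i j => by simp [tensorOpProd_ket, add_mul]
  map_sum F T s

theorem tensorOpProd_smul_left (c : ℂ) (T : Op I J) (S : Op K L) :
    tensorOpProd (c • T) S = c • tensorOpProd T S :=
  op_ext fun i j => by simp [tensorOpProd_ket, mul_assoc]

theorem ampl_eq_tensorOpProd (T : Op I J) : ampl K T = tensorOpProd T (1 : Op K K) := by
  refine map_ext_ket fun ⟨i, c⟩ => lp.ext (funext fun ⟨j, d⟩ => ?_)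
  rw [tensorOpProd_ket, ampl_apply]
  obtain rfl | h := eq_or_ne d c
  · have : slice (ket (i, d)) d = ket i := lp.ext (funext fun a => by
      classical
      change ket (i, d) (a, d) = _
      simp [ket_apply])
    simp [this, ket_self]
  · have : slice (ket (i, c)) d = 0 := lp.ext (funext fun a => ket_of_ne fun h' =>
      h (Prod.ext_iff.1 h').2)
    simp [this, ket_of_ne h]

theorem ampl_adjoint (T : Op I J) : ContinuousLinearMap.adjoint (ampl K T) = ampl K (T†) := by
  rw [ampl_eq_tensorOpProd, tensorOpProd_adjoint, ampl_eq_tensorOpProd]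
  congr 1
  exact ContinuousLinearMap.adjoint_id

theorem ampl_comp_tensorOpProd_one (T : Op I J) (S : Op K L) :
    ampl L T ∘L tensorOpProd 1 S = tensorOpProd 1 S ∘L ampl K T := by
  simp only [ampl_eq_tensorOpProd, tensorOpProd_comp, ContinuousLinearMap.one_def,
    ContinuousLinearMap.comp_id, ContinuousLinearMap.id_comp]

end Binary

/-! ### Reindexing, restricting and embedding basis sets -/

section Reindex

variable {I J : Type}

theorem reindexOp_apply (e : I ≃ J) (f : Hilb I) (j : J) : reindexOp e f j = f (e.symm j) := rfl

theorem reindexOp_ket (e : I ≃ J) (i : I) : reindexOp e (ket i) = ket (e i) :=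
  reindex_symm_ket e.symm i

theorem reindexOp_comp_symm (e : I ≃ J) : reindexOp e ∘L reindexOp e.symm = 1 :=
  map_ext_ket fun i => by simp [reindexOp_ket]

theorem reindexOp_adjoint (e : I ≃ J) :
    ContinuousLinearMap.adjoint (reindexOp e) = reindexOp e.symm := by
  classical
  refine op_ext fun j i => ?_
  rw [adjoint_ket_apply, reindexOp_ket, reindexOp_ket]
  simp [ket_apply, Equiv.eq_symm_apply, eq_comm]

end Reindex

section Embedding

variable {I J K : Type}

/-- The restriction of the coefficients along an injection of the basis sets. -/
noncomputable def restrictOp (j : I ↪ J) : Op J I :=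
  LinearMap.mkContinuous
    { toFun := fun f => (⟨fun i => f (j i),
        memHilb ((hilb_summable f).comp_injective j.injective)⟩ : Hilb I)
      map_add' := fun _ _ => rfl
      map_smul' := fun _ _ => rfl } 1 fun f => by
    rw [one_mul]
    refine (pow_le_pow_iff_left₀ (norm_nonneg _) (norm_nonneg _) two_ne_zero).1 ?_
    rw [hilb_norm_sq, hilb_norm_sq]
    exact tsum_comp_le_tsum_of_inj (hilb_summable f) (fun _ => sq_nonneg _) j.injective

theorem restrictOp_apply (j : I ↪ J) (f : Hilb J) (i : I) : restrictOp j f i = f (j i) := rfl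

/-- The isometry extending the coefficients by zero along an injection of the basis sets. -/
noncomputable def embedOp (j : I ↪ J) : Op I J := (restrictOp j)†

theorem adjoint_embedOp (j : I ↪ J) : ContinuousLinearMap.adjoint (embedOp j) = restrictOp j :=
  ContinuousLinearMap.adjoint_adjoint _

theorem embedOp_ket (j : I ↪ J) (i : I) : embedOp j (ket i) = ket (j i) := by
  classical
  refine lp.ext (funext fun b => ?_)
  rw [embedOp, adjoint_ket_apply, restrictOp_apply]
  simp [ket_apply, eq_comm]

theorem restrictOp_comp_embedOp (j : I ↪ J) : restrictOp j ∘L embedOp j = 1 := by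
  classical
  refine op_ext fun i i' => ?_
  rw [ContinuousLinearMap.comp_apply, embedOp_ket, restrictOp_apply]
  simp [ket_apply]

theorem restrictOp_comp_embedOp_of_disjoint {j : I ↪ J} {l : K ↪ J} (h : ∀ i k, j i ≠ l k) :
    restrictOp j ∘L embedOp l = 0 :=
  op_ext fun k i => by
    rw [ContinuousLinearMap.comp_apply, embedOp_ket, restrictOp_apply]
    exact ket_of_ne (h i k)

theorem norm_embedOp (j : I ↪ J) (f : Hilb I) : ‖embedOp j f‖ = ‖f‖ := by
  refine (ContinuousLinearMap.norm_map_iff_adjoint_comp_self _).2 ?_ f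
  rw [adjoint_embedOp, restrictOp_comp_embedOp]

theorem tensorOp_restrictOp {ι : Type} [Fintype ι] {I J : ι → Type} (j : ∀ k, I k ↪ J k) :
    tensorOp (fun k => restrictOp (j k)) = restrictOp (Function.Embedding.piCongrRight j) := by
  classical
  refine op_ext fun i b => ?_
  rw [tensorOp_ket, restrictOp_apply]
  simp only [restrictOp_apply, ket_apply]
  rw [Finset.prod_ite_zero]
  simp [funext_iff]

theorem restrictOp_sectL_comp_ampl (c : K) (T : Op I J) :
    restrictOp (.sectL J c) ∘L ampl K T = T ∘L restrictOp (.sectL I c) := rfl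

theorem ampl_comp_embedOp_sectL (c : K) (T : Op I J) :
    ampl K T ∘L embedOp (.sectL I c) = embedOp (.sectL J c) ∘L T := by
  have := congrArg ContinuousLinearMap.adjoint (restrictOp_sectL_comp_ampl c (T†))
  rwa [ContinuousLinearMap.adjoint_comp, ContinuousLinearMap.adjoint_comp, ampl_adjoint,
    ContinuousLinearMap.adjoint_adjoint] at this

end Embedding

/-! ### Operators on one tensor factor -/

/-- `T ↦ T ⊗ 𝟙` as a homomorphism of `⋆`-algebras. -/
noncomputable def amplHom (I K : Type) : Op I I →⋆ₐ[ℂ] Op (I × K) (I × K) where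
  toFun := ampl K
  map_one' := rfl
  map_mul' _ _ := rfl
  map_zero' := rfl
  map_add' _ _ := rfl
  commutes' _ := rfl
  map_star' T := (ampl_adjoint T).symm

theorem update_comp_update {ι : Type} [DecidableEq ι] {I J K : ι → Type}
    (S : ∀ k, Op (J k) (K k)) (T : ∀ k, Op (I k) (J k)) (k : ι)
    (s : Op (J k) (K k)) (t : Op (I k) (J k)) :
    (fun j => Function.update S k s j ∘L Function.update T k t j)
      = Function.update (fun j => S j ∘L T j) k (s ∘L t) :=
  funext fun j => by
    obtain rfl | h := eq_or_ne j k
    · simp only [Function.update_self]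
    · simp only [Function.update_of_ne h]

section LocalOp

variable {ι : Type} [Fintype ι] [DecidableEq ι] {I J : ι → Type}

theorem localOp_comp (k : ι) (S T : Op (I k) (I k)) :
    localOp k S ∘L localOp k T = localOp k (S ∘L T) := by
  rw [localOp, localOp, tensorOp_comp, update_comp_update]
  rfl

theorem localOp_one (k : ι) : localOp k (1 : Op (I k) (I k)) = 1 := by
  rw [localOp, Function.update_eq_self, tensorOp_one]

theorem localOp_adjoint (k : ι) (T : Op (I k) (I k)) :
    ContinuousLinearMap.adjoint (localOp k T) = localOp k (T†) := by
  rw [localOp, tensorOp_adjoint, localOp]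
  congr 1
  funext j
  obtain rfl | h := eq_or_ne j k
  · simp only [Function.update_self]
  · simp only [Function.update_of_ne h]
    exact ContinuousLinearMap.adjoint_id

theorem localOp_commute {k l : ι} (h : k ≠ l) (S : Op (I k) (I k)) (T : Op (I l) (I l)) :
    localOp k S ∘L localOp l T = localOp l T ∘L localOp k S := by
  rw [localOp, localOp, tensorOp_comp, tensorOp_comp]
  congr 1
  funext j
  obtain rfl | hk := eq_or_ne j k
  · rw [Function.update_self, Function.update_of_ne h]
    rfl
  · rw [Function.update_of_ne hk]
    rfl

/-- The embedding of the operators on one factor, as a homomorphism of `⋆`-algebras. -/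
noncomputable def localOpHom (I : ι → Type) (k : ι) :
    Op (I k) (I k) →⋆ₐ[ℂ] Op (∀ k, I k) (∀ k, I k) :=
  { AlgHom.ofLinearMap
      ((tensorOpMultilinear I I).toLinearMap (fun j => (1 : Op (I j) (I j))) k)
      (localOp_one k) (fun S T => (localOp_comp k S T).symm) with
    map_star' := fun T => (localOp_adjoint k T).symm }

theorem localOpHom_apply (k : ι) (T : Op (I k) (I k)) : localOpHom I k T = localOp k T := rfl

theorem localOp_ket_update (k : ι) (T : Op (I k) (I k)) (i : ∀ k, I k) (a b : I k) :
    localOp k T (ket (Function.update i k a)) (Function.update i k b) = T (ket a) b := by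
  rw [localOp, tensorOp_update_ket, Function.update_self, Function.update_self,
    Finset.prod_eq_one, mul_one]
  intro l _
  rw [Function.update_of_ne l.2, Function.update_of_ne l.2, one_apply_eq_self, ket_self]

theorem localOp_injective [∀ k, Nonempty (I k)] (k : ι) :
    Function.Injective (localOp (I := I) k) := fun S T h => by
  let i : ∀ k, I k := fun k => Classical.arbitrary _
  exact op_ext fun a b => by rw [← localOp_ket_update k S i, h, localOp_ket_update]

theorem tensorOp_piecewise_insert (T : ∀ k, Op (I k) (I k)) {s : Finset ι} {k : ι} (hk : k ∉ s) :
    tensorOp ((insert k s).piecewise T 1) = localOp k (T k) ∘L tensorOp (s.piecewise T 1) := by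
  rw [localOp, tensorOp_comp]
  congr 1
  funext j
  obtain rfl | h := eq_or_ne j k
  · simp [hk]
    rfl
  · simp [h, Finset.piecewise]
    rfl

theorem map_tensorOp_comp_of_intertwines {N : Type} {S : ∀ k, Op (J k) (J k)}
    {T : ∀ k, Op (I k) (I k)} (F : Op (∀ k, J k) (∀ k, J k) →ₐ[ℂ] Op N N) {W : Op (∀ k, I k) N}
    (h : Intertwines (fun k => F (localOp k (S k))) (fun k => localOp k (T k)) W) :
    F (tensorOp S) ∘L W = W ∘L tensorOp T := by
  have key : ∀ s : Finset ι,
      F (tensorOp (s.piecewise S 1)) ∘L W = W ∘L tensorOp (s.piecewise T 1) := fun s => by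
    induction s using Finset.induction_on with
    | empty =>
      rw [Finset.piecewise_empty, Finset.piecewise_empty]
      exact (congrArg₂ (fun X Y => F X ∘L W = W ∘L Y) tensorOp_one tensorOp_one).mpr
        (by rw [map_one]; rfl)
    | insert k s hk ih =>
      rw [tensorOp_piecewise_insert S hk, tensorOp_piecewise_insert T hk,
        ← ContinuousLinearMap.comp_assoc W, ← h k, ContinuousLinearMap.comp_assoc, ← ih,
        ← ContinuousLinearMap.comp_assoc]
      exact congrArg (· ∘L W) (map_mul F _ _)
  simpa only [Finset.piecewise_univ] using key Finset.univ

theorem tensorOp_comp_of_intertwines {S : ∀ k, Op (J k) (J k)} {T : ∀ k, Op (I k) (I k)}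
    {W : Op (∀ k, I k) (∀ k, J k)}
    (h : Intertwines (fun k => localOp k (S k)) (fun k => localOp k (T k)) W) :
    tensorOp S ∘L W = W ∘L tensorOp T :=
  map_tensorOp_comp_of_intertwines (AlgHom.id ℂ _) h

/-- All the operators `𝟙 ⊗ … ⊗ A⁽ᵏ⁾_{a|x} ⊗ … ⊗ 𝟙`. -/
noncomputable def localOps {L : ι → Leg} (A : ∀ k, OpSystem (L k) (I k)) :
    (Σ k, (L k).Event) → Op (∀ k, I k) (∀ k, I k) :=
  fun p => localOp p.1 (A p.1 p.2)

theorem tensorPolynomials_eq_adjoin {L : ι → Leg} (A : ∀ k, OpSystem (L k) (I k)) :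
    tensorPolynomials A = Algebra.adjoin ℂ (Set.range (localOps A)) := by
  rw [tensorPolynomials]
  congr 1
  ext T
  simp [localOps, eq_comm]

end LocalOp

/-! ### Bipartite splittings -/

/-- The operators `S a ⊗ 𝟙` and `𝟙 ⊗ T b` on a bipartite space. -/
noncomputable def bipartiteOps {I K α β : Type} (S : α → Op I I) (T : β → Op K K) :
    α ⊕ β → Op (I × K) (I × K) :=
  Sum.elim (fun a => ampl K (S a)) fun b => tensorOpProd 1 (T b)

section Events

variable {α β ι : Type}

/-- The events of a disjoint union of two sets of parties. -/
def sumEvent (L : α ⊕ β → Leg) :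
    (Σ a, (L (.inl a)).Event) ⊕ (Σ b, (L (.inr b)).Event) → Σ k, (L k).Event :=
  Sum.elim (fun p => ⟨.inl p.1, p.2⟩) fun p => ⟨.inr p.1, p.2⟩

theorem sumEvent_surjective (L : α ⊕ β → Leg) : Function.Surjective (sumEvent L) := by
  rintro ⟨a | b, e⟩
  exacts [⟨.inl ⟨a, e⟩, rfl⟩, ⟨.inr ⟨b, e⟩, rfl⟩]

/-- The events of the party `k` and those of the other parties. -/
def splitEvent [DecidableEq ι] (L : ι → Leg) (k : ι) :
    (L k).Event ⊕ (Σ j : {j // j ≠ k}, (L j).Event) → Σ j, (L j).Event :=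
  Sum.elim (fun e => ⟨k, e⟩) fun p => ⟨p.1, p.2⟩

theorem splitEvent_surjective [DecidableEq ι] (L : ι → Leg) (k : ι) :
    Function.Surjective (splitEvent L k) := by
  rintro ⟨j, e⟩
  obtain rfl | h := eq_or_ne j k
  exacts [⟨.inl e, rfl⟩, ⟨.inr ⟨⟨j, h⟩, e⟩, rfl⟩]

end Events

section Split

variable {α β : Type} [Fintype α] [Fintype β]

theorem reindexOp_sumPi_comp_tensorOp {I J : α ⊕ β → Type} (T : ∀ k, Op (I k) (J k)) :
    reindexOp (Equiv.sumPiEquivProdPi J) ∘L tensorOp T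
      = tensorOpProd (tensorOp fun a => T (.inl a)) (tensorOp fun b => T (.inr b))
        ∘L reindexOp (Equiv.sumPiEquivProdPi I) := by
  refine op_ext fun i j => ?_
  rw [ContinuousLinearMap.comp_apply, ContinuousLinearMap.comp_apply, reindexOp_apply,
    reindexOp_ket, tensorOpProd_ket, tensorOp_ket, tensorOp_ket, tensorOp_ket,
    Fintype.prod_sum_type]
  rfl

theorem reindexOp_sumPi_comp_localOp_inl [DecidableEq α] [DecidableEq β] {I : α ⊕ β → Type} (a : α)
    (T : Op (I (.inl a)) (I (.inl a))) :
    reindexOp (Equiv.sumPiEquivProdPi I) ∘L localOp (.inl a) T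
      = ampl _ (localOp (I := fun a => I (.inl a)) a T)
        ∘L reindexOp (Equiv.sumPiEquivProdPi I) := by
  rw [localOp, reindexOp_sumPi_comp_tensorOp, ampl_eq_tensorOpProd, ← tensorOp_one]
  congr 2
  · rw [localOp]
    congr 1
    funext j
    obtain rfl | h := eq_or_ne j a
    · simp only [Function.update_self]
    · simp [h]

theorem reindexOp_sumPi_comp_localOp_inr [DecidableEq α] [DecidableEq β] {I : α ⊕ β → Type} (b : β)
    (T : Op (I (.inr b)) (I (.inr b))) :
    reindexOp (Equiv.sumPiEquivProdPi I) ∘L localOp (.inr b) T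
      = tensorOpProd 1 (localOp (I := fun b => I (.inr b)) b T)
        ∘L reindexOp (Equiv.sumPiEquivProdPi I) := by
  rw [localOp, reindexOp_sumPi_comp_tensorOp]
  congr 2
  · simp [tensorOp_one]
  · rw [localOp]
    congr 1
    funext j
    obtain rfl | h := eq_or_ne j b
    · simp only [Function.update_self]
    · simp [h]

theorem intertwines_reindexOp_sumPi [DecidableEq α] [DecidableEq β] {L : α ⊕ β → Leg}
    {I : α ⊕ β → Type} (A : ∀ k, OpSystem (L k) (I k)) :
    Intertwines (bipartiteOps (localOps fun a => A (.inl a)) (localOps fun b => A (.inr b)))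
      (localOps A ∘ sumEvent L) (reindexOp (Equiv.sumPiEquivProdPi I)) := by
  rintro (⟨a, e⟩ | ⟨b, e⟩)
  exacts [(reindexOp_sumPi_comp_localOp_inl a _).symm, (reindexOp_sumPi_comp_localOp_inr b _).symm]

variable {ι : Type} [Fintype ι] [DecidableEq ι]

theorem reindexOp_piSplitAt_comp_tensorOp (k : ι) {I J : ι → Type} (T : ∀ k, Op (I k) (J k)) :
    reindexOp (Equiv.piSplitAt k J) ∘L tensorOp T
      = tensorOpProd (T k) (tensorOp fun j : {j // j ≠ k} => T j)
        ∘L reindexOp (Equiv.piSplitAt k I) := by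
  refine op_ext fun i j => ?_
  obtain ⟨j, rfl⟩ := (Equiv.piSplitAt k J).surjective j
  rw [ContinuousLinearMap.comp_apply, ContinuousLinearMap.comp_apply, reindexOp_apply,
    reindexOp_ket, tensorOpProd_ket, tensorOp_ket, tensorOp_ket, Equiv.symm_apply_apply,
    Fintype.prod_eq_mul_prod_subtype_ne _ k]
  rfl

theorem reindexOp_piSplitAt_comp_localOp_self (k : ι) {I : ι → Type} (T : Op (I k) (I k)) :
    reindexOp (Equiv.piSplitAt k I) ∘L localOp k T
      = ampl _ T ∘L reindexOp (Equiv.piSplitAt k I) := by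
  rw [localOp, reindexOp_piSplitAt_comp_tensorOp, ampl_eq_tensorOpProd, ← tensorOp_one]
  congr 2
  · simp
  · congr 1
    funext j
    simp [j.2]

theorem reindexOp_piSplitAt_comp_localOp_of_ne (k : ι) {I : ι → Type} (j : {j // j ≠ k})
    (T : Op (I j) (I j)) :
    reindexOp (Equiv.piSplitAt k I) ∘L localOp j.1 T
      = tensorOpProd 1 (localOp (I := fun j : {j // j ≠ k} => I j) j T)
        ∘L reindexOp (Equiv.piSplitAt k I) := by
  rw [localOp, reindexOp_piSplitAt_comp_tensorOp]
  congr 2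
  · simp [j.2.symm]
  · rw [localOp]
    congr 1
    funext l
    obtain rfl | h := eq_or_ne l j
    · simp only [Function.update_self]
    · simp [h, Subtype.coe_ne_coe.2 h]

theorem intertwines_reindexOp_piSplitAt {L : ι → Leg} (k : ι) {I : ι → Type}
    (A : ∀ k, OpSystem (L k) (I k)) :
    Intertwines (bipartiteOps (A k) (localOps fun j : {j // j ≠ k} => A j))
      (localOps A ∘ splitEvent L k) (reindexOp (Equiv.piSplitAt k I)) := by
  rintro (e | ⟨j, e⟩)
  exacts [(reindexOp_piSplitAt_comp_localOp_self k _).symm,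
    (reindexOp_piSplitAt_comp_localOp_of_ne k j _).symm]

end Split

/-! ### Systems of measurement operators -/

section POVM

variable {l : Leg} {I J : Type} {A : OpSystem l I}

theorem IsPOVM.isSelfAdjoint (h : IsPOVM A) (e : l.Event) : IsSelfAdjoint (A e) :=
  (h.1 e).isSelfAdjoint

theorem IsPOVM.conj (h : IsPOVM A) {S : Op I J} (hS : S ∘L (S†) = 1) :
    IsPOVM fun e => S ∘L A e ∘L (S†) := by
  refine ⟨fun e => (h.1 e).conj_adjoint S, fun x => ?_⟩
  rw [← ContinuousLinearMap.comp_finsetSum, ← ContinuousLinearMap.finsetSum_comp, h.2 x]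
  exact hS

theorem IsPOVM.of_reindex {B : OpSystem l J} (h : IsPOVM A) (e : I ≃ J)
    (hAB : Intertwines B A (reindexOp e)) : IsPOVM B := by
  have he : reindexOp e ∘L ((reindexOp e)†) = 1 := by
    rw [reindexOp_adjoint, reindexOp_comp_symm]
  convert h.conj he using 2 with o
  rw [← ContinuousLinearMap.comp_assoc, ← hAB o, ContinuousLinearMap.comp_assoc, he]
  rfl

/-- The events with setting `x`. -/
def settingEvents (l : Leg) (x : Fin l.settings) : Finset l.Event :=
  Finset.univ.map (Function.Embedding.sigmaMk x)

theorem IsPOVM.sum_settingEvents (h : IsPOVM A) (x : Fin l.settings) :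
    ∑ e ∈ settingEvents l x, A e = 1 := by
  rw [settingEvents, Finset.sum_map]
  exact h.2 x

end POVM

section BellOp

variable {ι : Type} [Fintype ι] [DecidableEq ι] {L : ι → Leg} {I J : ι → Type}
  {A : ∀ k, OpSystem (L k) (I k)} {A' : ∀ k, OpSystem (L k) (J k)}

theorem isSelfAdjoint_localOps (hA : ∀ k, IsPOVM (A k)) (p : Σ k, (L k).Event) :
    IsSelfAdjoint (localOps A p) :=
  ((hA p.1).isSelfAdjoint p.2).map (localOpHom I p.1)

theorem sum_tensorOp_eq_one (hA : ∀ k, IsPOVM (A k)) (x : ∀ k, Fin (L k).settings) :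
    ∑ r ∈ Fintype.piFinset (fun k => settingEvents (L k) (x k)), tensorOp (fun k => A k (r k))
      = 1 := by
  rw [← tensorOp_sum, ← tensorOp_one]
  congr 1
  exact funext fun k => (hA k).sum_settingEvents _

theorem sum_tensorOp_eq_localOp (hA : ∀ k, IsPOVM (A k)) (x : ∀ k, Fin (L k).settings) (k : ι)
    (e : (L k).Event) :
    ∑ r ∈ Fintype.piFinset (Function.update (fun k => settingEvents (L k) (x k)) k {e}),
      tensorOp (fun k => A k (r k)) = localOp k (A k e) := by
  rw [← tensorOp_sum, localOp]
  congr 1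
  funext j
  obtain rfl | h := eq_or_ne j k
  · simp
  · simp only [Function.update_of_ne h]
    exact (hA j).sum_settingEvents _

theorem isSelfAdjoint_bellOp (B : BellFunctional L) (hA : ∀ k, IsPOVM (A k)) :
    IsSelfAdjoint (bellOp B A) := by
  refine isSelfAdjoint_sum _ fun e _ => ?_
  refine IsSelfAdjoint.smul (Complex.conj_ofReal _) ?_
  rw [ContinuousLinearMap.isSelfAdjoint_iff', tensorOp_adjoint]
  congr 1
  exact funext fun k => ((hA k).isSelfAdjoint (e k)).adjoint_eq

theorem map_bellOp_comp_of_intertwines {N : Type} (F : Op (∀ k, I k) (∀ k, I k) →ₐ[ℂ] Op N N)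
    {W : Op (∀ k, J k) N} (h : Intertwines (F ∘ localOps A) (localOps A') W)
    (B : BellFunctional L) : F (bellOp B A) ∘L W = W ∘L bellOp B A' := by
  rw [bellOp, bellOp, map_sum, ContinuousLinearMap.finsetSum_comp,
    ContinuousLinearMap.comp_finsetSum]
  refine Finset.sum_congr rfl fun e _ => ?_
  rw [map_smul, ContinuousLinearMap.smul_comp, ContinuousLinearMap.comp_smul,
    map_tensorOp_comp_of_intertwines F fun k => h ⟨k, e k⟩]

theorem bellOp_comp_of_intertwines {W : Op (∀ k, J k) (∀ k, I k)}
    (h : Intertwines (localOps A) (localOps A') W) (B : BellFunctional L) :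
    bellOp B A ∘L W = W ∘L bellOp B A' :=
  map_bellOp_comp_of_intertwines (AlgHom.id ℂ _) h B

theorem IsNormalized.re_inner_le {B : BellFunctional L} (hB : IsNormalized B)
    (hA : ∀ k, IsPOVM (A k)) (v : Hilb (∀ k, I k)) :
    (inner ℂ v (bellOp B A v)).re ≤ ‖v‖ ^ 2 := by
  obtain rfl | hv := eq_or_ne v 0
  · simp
  have hn : 0 < ‖v‖ := norm_pos_iff.2 hv
  have h := hB.2 ⟨I, A, ((‖v‖⁻¹ : ℝ) : ℂ) • v, hA, by simp [norm_smul, hn.ne'], rfl⟩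
  rwa [map_smul, inner_smul_left, inner_smul_right, Complex.conj_ofReal, Complex.re_ofReal_mul,
    Complex.re_ofReal_mul, ← mul_assoc, ← mul_inv, inv_mul_le_iff₀ (by positivity), mul_one,
    ← sq] at h

end BellOp

/-! ### The intertwiners provided by a full self-test -/

theorem exists_linearIsometry_apply_eq {ι 𝕜 E F : Type*} [RCLike 𝕜] [NormedAddCommGroup E]
    [InnerProductSpace 𝕜 E] [NormedAddCommGroup F] [InnerProductSpace 𝕜 F] [Fintype ι]
    (b : OrthonormalBasis ι 𝕜 E) {v : ι → F} (hv : Orthonormal 𝕜 v) :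
    ∃ W : E →ₗᵢ[𝕜] F, ∀ i, W (b i) = v i := by
  have hW : ∀ i, b.toBasis.constr 𝕜 v (b i) = v i := fun i => by
    rw [← b.coe_toBasis, Module.Basis.constr_basis]
  have hv' : Orthonormal 𝕜 (b.toBasis.constr 𝕜 v ∘ b.toBasis) := by
    convert hv using 1
    exact funext fun i => by rw [Function.comp_apply, b.coe_toBasis, hW]
  have hb : Orthonormal 𝕜 b.toBasis := by rw [b.coe_toBasis]; exact b.orthonormal
  exact ⟨(b.toBasis.constr 𝕜 v).isometryOfOrthonormal hb hv', hW⟩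

section ProductBasis

variable {ι : Type} [Fintype ι] {d : ι → ℕ}

theorem inner_prodVec (x y : ∀ k, Hilb (Fin (d k))) :
    inner ℂ (prodVec x) (prodVec y) = ∏ k, inner ℂ (x k) (y k) := by
  classical
  simp only [lp.inner_eq_tsum, tsum_fintype, Finset.prod_univ_sum, Fintype.piFinset_univ]
  refine Finset.sum_congr rfl fun i _ => ?_
  simp only [prodVec, RCLike.inner_apply, map_prod, Finset.prod_mul_distrib]

theorem prodVec_ket (i : ∀ k, Fin (d k)) : prodVec (fun k => ket (i k)) = ket i := by
  classical
  refine lp.ext (funext fun j => ?_)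
  change ∏ k, ket (i k) (j k) = ket i j
  simp only [ket_apply, funext_iff, Finset.prod_ite_zero, Finset.mem_univ, true_imp_iff,
    Finset.prod_const_one]

theorem orthonormal_prodVec (b : ∀ k, OrthonormalBasis (Fin (d k)) ℂ (Hilb (Fin (d k)))) :
    Orthonormal ℂ fun i : ∀ k, Fin (d k) => prodVec fun k => b k (i k) := by
  classical
  refine orthonormal_iff_ite.2 fun i j => ?_
  simp only [inner_prodVec, (orthonormal_iff_ite.1 (b _).orthonormal), funext_iff,
    Finset.prod_ite_zero, Finset.mem_univ, true_imp_iff, Finset.prod_const_one]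

/-- The orthonormal basis of `⨂ₖ Hₖ` consisting of the product vectors of orthonormal bases of the
factors. -/
noncomputable def prodBasis [DecidableEq ι]
    (b : ∀ k, OrthonormalBasis (Fin (d k)) ℂ (Hilb (Fin (d k)))) :
    OrthonormalBasis (∀ k, Fin (d k)) ℂ (Hilb (∀ k, Fin (d k))) :=
  OrthonormalBasis.mk (orthonormal_prodVec b)
    ((orthonormal_prodVec b).linearIndependent.span_eq_top_of_card_eq_finrank'
      (Module.finrank_eq_card_basis (ketBasis _).toBasis).symm).ge

theorem prodBasis_apply [DecidableEq ι]
    (b : ∀ k, OrthonormalBasis (Fin (d k)) ℂ (Hilb (Fin (d k)))) (i : ∀ k, Fin (d k)) :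
    prodBasis b i = prodVec fun k => b k (i k) :=
  congrFun (OrthonormalBasis.coe_mk _ _) i

end ProductBasis

theorem norm_tensorOp_linearIsometry {ι : Type} [Fintype ι] {I J : ι → Type}
    (U : ∀ k, Hilb (I k) →ₗᵢ[ℂ] Hilb (J k)) (v : Hilb (∀ k, I k)) :
    ‖tensorOp (fun k => (U k).toContinuousLinearMap) v‖ = ‖v‖ := by
  refine (ContinuousLinearMap.norm_map_iff_adjoint_comp_self _).2 ?_ v
  rw [tensorOp_adjoint, tensorOp_comp, ← tensorOp_one]
  congr 1
  exact funext fun k => (U k).adjoint_comp_self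

section SelfTest

variable {ι : Type} [Fintype ι] [DecidableEq ι] {L : ι → Leg} {I J : ι → Type}

/-- Summing over the outcomes of all parties but one isolates the operators of that party. -/
theorem intertwines_localOps_of_forall_tensorOp {A : ∀ k, OpSystem (L k) (I k)}
    {A' : ∀ k, OpSystem (L k) (J k)} (hA : ∀ k, IsPOVM (A k)) (hA' : ∀ k, IsPOVM (A' k))
    (x : ∀ k, Fin (L k).settings) {M : Type*} [AddCommGroup M] [Module ℂ M]
    {W : Op (∀ k, J k) (∀ k, I k)} {X : Hilb (∀ k, I k) →ₗ[ℂ] M} (hX : Function.Injective X)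
    {Y : Hilb (∀ k, J k) →ₗ[ℂ] M}
    (h : ∀ (e : ∀ k, (L k).Event) φ,
      X (tensorOp (fun k => A k (e k)) (W φ)) = Y (tensorOp (fun k => A' k (e k)) φ)) :
    Intertwines (localOps A) (localOps A') W := by
  rintro ⟨k, e⟩
  have hsum : ∀ (s : Finset (∀ k, (L k).Event)) φ,
      X ((∑ r ∈ s, tensorOp fun k => A k (r k)) (W φ))
        = Y ((∑ r ∈ s, tensorOp fun k => A' k (r k)) φ) := fun s φ => by
    simp only [sum_apply, map_sum, h]
  have hlocal := hsum (Fintype.piFinset <|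
    Function.update (fun k => settingEvents (L k) (x k)) k {e})
  have hone := hsum (Fintype.piFinset fun k => settingEvents (L k) (x k))
  rw [sum_tensorOp_eq_localOp hA, sum_tensorOp_eq_localOp hA'] at hlocal
  rw [sum_tensorOp_eq_one hA, sum_tensorOp_eq_one hA'] at hone
  ext1 φ
  exact hX ((hlocal φ).trans (hone _).symm)

variable {d : ι → ℕ} {B : BellFunctional L} {A' : ∀ k, OpSystem (L k) (Fin (d k))}
  {ψ' : Hilb (∀ k, Fin (d k))}

namespace FullySelfTests

theorem isPOVM (h : FullySelfTests B A' ψ') (k : ι) : IsPOVM (A' k) :=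
  (h.projective k).1

theorem exists_linearIsometry (h : FullySelfTests B A' ψ') {A : ∀ k, OpSystem (L k) (I k)}
    (hA : ∀ k, IsPOVM (A k)) {ψ : Hilb (∀ k, I k)} (hψ : ‖ψ‖ = 1)
    (hv : (inner ℂ ψ (bellOp B A ψ)).re = 1) :
    ∃ W : Hilb (∀ k, Fin (d k)) →ₗᵢ[ℂ] Hilb (∀ k, I k), W ψ' = ψ ∧
      Intertwines (localOps A) (localOps A') W.toContinuousLinearMap := by
  obtain ⟨b, Ψ, hΨ, hψΨ, K, junk, U, -, hU⟩ := h.self_test I A ψ hA hψ hv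
  obtain ⟨e₀⟩ : Nonempty (∀ k, (L k).Event) := by
    by_contra hne
    rw [not_nonempty_iff] at hne
    simp [bellOp] at hv
  obtain ⟨W, hW⟩ := exists_linearIsometry_apply_eq (prodBasis b) hΨ
  refine ⟨W, ?_, ?_⟩
  · conv_lhs => rw [← (prodBasis b).sum_repr' ψ']
    simp only [hψΨ, map_sum, map_smul, ← hW, prodBasis_apply]
  let X : Hilb (∀ k, I k) →ₗ[ℂ] ((∀ k, Fin (d k) × K k) → ℂ) :=
    LinearMap.pi fun f => (lp.evalCLM ℂ (fun _ => ℂ) 2 f).toLinearMap ∘ₗ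
      (tensorOp fun k => (U k).toContinuousLinearMap).toLinearMap
  let Y : Hilb (∀ k, Fin (d k)) →ₗ[ℂ] ((∀ k, Fin (d k) × K k) → ℂ) :=
    LinearMap.pi fun f => junk (fun k => (f k).2) •
      (lp.evalCLM ℂ (fun _ => ℂ) 2 fun k => (f k).1).toLinearMap
  have hX : Function.Injective X := fun v w hvw =>
    (AddMonoidHomClass.isometry_of_norm _ (norm_tensorOp_linearIsometry U)).injective (lp.ext hvw)
  refine intertwines_localOps_of_forall_tensorOp hA h.isPOVM (fun k => (e₀ k).1) hX (Y := Y) ?_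
  intro e φ
  suffices hXY : X ∘ₗ (tensorOp fun k => A k (e k)).toLinearMap ∘ₗ W.toLinearMap
      = Y ∘ₗ (tensorOp fun k => A' k (e k)).toLinearMap from DFunLike.congr_fun hXY φ
  refine (prodBasis b).toBasis.ext fun i => funext fun f => ?_
  rw [OrthonormalBasis.coe_toBasis]
  change tensorOp _ (tensorOp _ (W (prodBasis b i))) f
    = junk _ * tensorOp _ (prodBasis b i) _
  rw [hW, prodBasis_apply, hU, mul_comm]

theorem bellOp_apply_state (h : FullySelfTests B A' ψ') : bellOp B A' ψ' = ψ' := by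
  obtain ⟨I, A, ψ, hA, hψ, hv⟩ := h.normalized.1
  obtain ⟨W, rfl, hW⟩ := h.exists_linearIsometry hA hψ hv.symm
  refine apply_eq_self_of_re_inner_eq (isSelfAdjoint_bellOp B h.isPOVM)
    (h.normalized.re_inner_le h.isPOVM) ?_
  have hBW : bellOp B A (W ψ') = W (bellOp B A' ψ') :=
    DFunLike.congr_fun (bellOp_comp_of_intertwines hW B) ψ'
  rw [h.norm_state, one_pow, hv, hBW, W.inner_map_map]

theorem cyclicSubspace_eq_top (h : FullySelfTests B A' ψ') :
    cyclicSubspace (localOps A') ψ' = ⊤ := by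
  refine SetLike.coe_injective ?_
  rw [coe_cyclicSubspace, ← tensorPolynomials_eq_adjoin, h.cyclic, Submodule.top_coe]

theorem eq_of_intertwines (h : FullySelfTests B A' ψ') {F : Type*} [NormedAddCommGroup F]
    [NormedSpace ℂ F] {S : (Σ k, (L k).Event) → F →L[ℂ] F}
    {X Y : Hilb (∀ k, Fin (d k)) →L[ℂ] F} (hX : Intertwines S (localOps A') X)
    (hY : Intertwines S (localOps A') Y) (hψ : X ψ' = Y ψ') : X = Y :=
  ContinuousLinearMap.ext fun _ =>
    hX.eqOn_cyclicSubspace hY hψ (h.cyclicSubspace_eq_top ▸ Submodule.mem_top)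

theorem exists_intertwiner_of_bellOp_apply_eq (h : FullySelfTests B A' ψ')
    {A : ∀ k, OpSystem (L k) (I k)} (hA : ∀ k, IsPOVM (A k)) {w : Hilb (∀ k, I k)}
    (hw : bellOp B A w = w) :
    ∃ T : Op (∀ k, Fin (d k)) (∀ k, I k), T ψ' = w ∧ Intertwines (localOps A) (localOps A') T ∧
      ∀ v, ‖T v‖ = ‖w‖ * ‖v‖ := by
  obtain rfl | hw0 := eq_or_ne w 0
  · exact ⟨0, rfl, fun _ => by simp, fun _ => by simp⟩
  have hn : (‖w‖ : ℂ) ≠ 0 := Complex.ofReal_ne_zero.2 (norm_ne_zero_iff.2 hw0)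
  have hunit : ‖(‖w‖ : ℂ)⁻¹ • w‖ = 1 := norm_smul_inv_norm hw0
  obtain ⟨W, hWψ, hW⟩ := h.exists_linearIsometry hA hunit (by
    rw [map_smul, hw, ← RCLike.re_to_complex, inner_self_eq_norm_sq (𝕜 := ℂ), hunit, one_pow])
  refine ⟨(‖w‖ : ℂ) • W.toContinuousLinearMap, ?_, hW.smul _, fun v => ?_⟩
  · change (‖w‖ : ℂ) • W ψ' = w
    rw [hWψ, smul_inv_smul₀ hn]
  · change ‖(‖w‖ : ℂ) • W v‖ = _
    rw [norm_smul, W.norm_map, Complex.norm_real, norm_norm]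

theorem norm_intertwiner_apply (h : FullySelfTests B A' ψ') {A : ∀ k, OpSystem (L k) (I k)}
    (hA : ∀ k, IsPOVM (A k)) {Y : Op (∀ k, Fin (d k)) (∀ k, I k)}
    (hY : Intertwines (localOps A) (localOps A') Y) (v : Hilb (∀ k, Fin (d k))) :
    ‖Y v‖ = ‖Y ψ'‖ * ‖v‖ := by
  have hfix : bellOp B A (Y ψ') = Y ψ' := by
    rw [← ContinuousLinearMap.comp_apply, bellOp_comp_of_intertwines hY,
      ContinuousLinearMap.comp_apply, h.bellOp_apply_state]
  obtain ⟨T, hTψ, hT, hnorm⟩ := h.exists_intertwiner_of_bellOp_apply_eq hA hfix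
  rw [h.eq_of_intertwines hY hT hTψ.symm, hnorm, hTψ]

theorem exists_eq_smul_one_of_intertwines (h : FullySelfTests B A' ψ')
    {Z : Op (∀ k, Fin (d k)) (∀ k, Fin (d k))}
    (hZ : Intertwines (localOps A') (localOps A') Z) : ∃ z : ℂ, Z = z • 1 := by
  have : Nontrivial (Hilb (∀ k, Fin (d k))) :=
    nontrivial_of_ne ψ' 0 (norm_ne_zero_iff.1 (h.norm_state ▸ one_ne_zero))
  obtain ⟨z, hz⟩ := Module.End.exists_eigenvalue Z.toLinearMap
  obtain ⟨v, hv, hv0⟩ := hz.exists_hasEigenvector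
  have hZz : Intertwines (localOps A') (localOps A') (Z - z • 1) :=
    hZ.sub (Intertwines.smul z fun _ => rfl)
  have hker : (Z - z • 1) v = 0 := sub_eq_zero.2 (Module.End.mem_eigenspace_iff.1 hv)
  have hψ : (Z - z • 1) ψ' = 0 := by
    have := h.norm_intertwiner_apply h.isPOVM hZz v
    rw [hker, norm_zero, zero_eq_mul] at this
    exact norm_eq_zero.1 (this.resolve_right (norm_ne_zero_iff.2 hv0))
  exact ⟨z, sub_eq_zero.1 (h.eq_of_intertwines hZz (fun _ => by simp) hψ)⟩

/-- An operator commuting with the measurements of one party acts on that party only, hence commutes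
with those of all parties. -/
theorem adjoin_range_eq_top (h : FullySelfTests B A' ψ') (k : ι) :
    Algebra.adjoin ℂ (Set.range (A' k)) = ⊤ := by
  refine adjoin_range_eq_top_of_commutant (h.isPOVM k).isSelfAdjoint fun Z hZ => ?_
  have hlocal : Intertwines (localOps A') (localOps A') (localOp k Z) := by
    rintro ⟨l, e⟩
    obtain rfl | hl := eq_or_ne l k
    · rw [localOps, localOp_comp, localOp_comp, hZ e]
    · exact localOp_commute hl _ _
  obtain ⟨z, hz⟩ := h.exists_eq_smul_one_of_intertwines hlocal
  have : ∀ l, Nonempty (Fin (d l)) := Classical.nonempty_pi.1 (nonempty_of_norm_eq_one h.norm_state)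
  refine ⟨z, localOp_injective (I := fun k => Fin (d k)) k ?_⟩
  rw [hz]
  change z • 1 = localOpHom _ k (z • 1)
  rw [map_smul, map_one]

end FullySelfTests

end SelfTest

/-! ### Singling out one party -/

theorem forall_of_split {ι : Type*} {k : ι} {p : ι → Prop} (hk : p k)
    (hr : ∀ j : {j // j ≠ k}, p j) (j : ι) : p j := by
  obtain rfl | h := eq_or_ne j k
  exacts [hk, hr ⟨j, h⟩]

theorem split_induction {ι : Type} {L : ι → Leg} (k : ι)
    {P : ∀ (Ik : Type) (Ir : {j // j ≠ k} → Type), OpSystem (L k) Ik →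
      (∀ j : {j // j ≠ k}, OpSystem (L j) (Ir j)) → Prop}
    (h : ∀ (I : ι → Type) (A : ∀ j, OpSystem (L j) (I j)),
      P (I k) (fun j => I j) (A k) (fun j => A j))
    (Ik : Type) (Ir : {j // j ≠ k} → Type) (Ak : OpSystem (L k) Ik)
    (Ar : ∀ j : {j // j ≠ k}, OpSystem (L j) (Ir j)) : P Ik Ir Ak Ar := by
  classical
  obtain ⟨I, hI⟩ := (Equiv.piSplitAt k (fun _ : ι => Type)).surjective (Ik, Ir)
  obtain ⟨rfl, rfl⟩ := Prod.mk.inj hI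
  obtain ⟨A, hA⟩ := (Equiv.piSplitAt k (fun j => OpSystem (L j) (I j))).surjective (Ak, Ar)
  obtain ⟨rfl, rfl⟩ := Prod.mk.inj hA
  exact h I A

section Split

variable {ι : Type} [Fintype ι] [DecidableEq ι] {L : ι → Leg}

/-- The Bell operator of a realization in which the party `k`, acting on `ℓ²(Ik)`, is separated from
the others, so that a contraction can replace its measurements and its space independently. -/
noncomputable def splitBellOp (k : ι) (B : BellFunctional L) {Ik : Type}
    {Ir : {j // j ≠ k} → Type} (Ak : OpSystem (L k) Ik)
    (Ar : ∀ j : {j // j ≠ k}, OpSystem (L j) (Ir j)) : Op (Ik × ∀ j, Ir j) (Ik × ∀ j, Ir j) :=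
  ∑ p : (L k).Event × ∀ j : {j // j ≠ k}, (L j).Event,
    (B ((Equiv.piSplitAt k fun j => (L j).Event).symm p) : ℂ) •
      tensorOpProd (Ak p.1) (tensorOp fun j => Ar j (p.2 j))

theorem reindexOp_piSplitAt_comp_bellOp (k : ι) (B : BellFunctional L) {I : ι → Type}
    (A : ∀ k, OpSystem (L k) (I k)) :
    reindexOp (Equiv.piSplitAt k I) ∘L bellOp B A
      = splitBellOp k B (A k) (fun j => A j) ∘L reindexOp (Equiv.piSplitAt k I) := by
  rw [bellOp, splitBellOp, ContinuousLinearMap.finsetSum_comp, ContinuousLinearMap.comp_finsetSum]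
  refine Fintype.sum_equiv (Equiv.piSplitAt k fun j => (L j).Event) _ _ fun e => ?_
  rw [ContinuousLinearMap.comp_smul, reindexOp_piSplitAt_comp_tensorOp, Equiv.symm_apply_apply,
    ContinuousLinearMap.smul_comp]
  rfl

theorem inner_splitBellOp_reindexOp (k : ι) (B : BellFunctional L) {I : ι → Type}
    (A : ∀ k, OpSystem (L k) (I k)) (v : Hilb (∀ k, I k)) :
    inner ℂ (reindexOp (Equiv.piSplitAt k I) v)
        (splitBellOp k B (A k) (fun j => A j) (reindexOp (Equiv.piSplitAt k I) v))
      = inner ℂ v (bellOp B A v) := by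
  rw [← ContinuousLinearMap.comp_apply, ← reindexOp_piSplitAt_comp_bellOp]
  exact (reindex (Equiv.piSplitAt k I)).inner_map_map _ _

theorem splitBellOp_comp_ampl {k : ι} {Ik Jk : Type} {Ir : {j // j ≠ k} → Type}
    (B : BellFunctional L) {Ak : OpSystem (L k) Ik} {Bk : OpSystem (L k) Jk}
    (Ar : ∀ j : {j // j ≠ k}, OpSystem (L j) (Ir j)) {V : Op Jk Ik} (h : Intertwines Ak Bk V) :
    splitBellOp k B Ak Ar ∘L ampl _ V = ampl _ V ∘L splitBellOp k B Bk Ar := by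
  rw [splitBellOp, splitBellOp, ContinuousLinearMap.finsetSum_comp,
    ContinuousLinearMap.comp_finsetSum]
  refine Finset.sum_congr rfl fun p _ => ?_
  rw [ContinuousLinearMap.comp_smul, ContinuousLinearMap.smul_comp, ampl_eq_tensorOpProd,
    tensorOpProd_comp, tensorOpProd_comp, h]
  rfl

theorem IsConnector.isPOVM_splitBellOp {out : Leg} {C : ConnTensor L out} (hC : IsConnector C)
    (k : ι) : ∀ (Ik : Type) (Ir : {j // j ≠ k} → Type) (Ak : OpSystem (L k) Ik)
      (Ar : ∀ j : {j // j ≠ k}, OpSystem (L j) (Ir j)),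
      IsPOVM Ak → (∀ j, IsPOVM (Ar j)) → IsPOVM fun o => splitBellOp k (C o) Ak Ar := by
  refine split_induction k fun I A hk hr => ?_
  exact (hC I A (forall_of_split hk hr)).of_reindex (Equiv.piSplitAt k I) fun o =>
    (reindexOp_piSplitAt_comp_bellOp k (C o) A).symm

theorem IsNormalized.re_inner_splitBellOp_le {B : BellFunctional L} (hB : IsNormalized B) (k : ι) :
    ∀ (Ik : Type) (Ir : {j // j ≠ k} → Type) (Ak : OpSystem (L k) Ik)
      (Ar : ∀ j : {j // j ≠ k}, OpSystem (L j) (Ir j)),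
      IsPOVM Ak → (∀ j, IsPOVM (Ar j)) → ∀ ψ : Hilb (Ik × ∀ j, Ir j),
      (inner ℂ ψ (splitBellOp k B Ak Ar ψ)).re ≤ ‖ψ‖ ^ 2 := by
  refine split_induction k fun I A hk hr ψ => ?_
  obtain ⟨ψ, rfl⟩ := (reindex (Equiv.piSplitAt k I)).surjective ψ
  rw [LinearIsometryEquiv.norm_map]
  have hval := inner_splitBellOp_reindexOp k B A ψ
  exact (congrArg Complex.re hval).trans_le (hB.re_inner_le (forall_of_split hk hr) ψ)

theorem FullySelfTests.exists_linearIsometry_split {d : ι → ℕ} {B : BellFunctional L}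
    {A' : ∀ k, OpSystem (L k) (Fin (d k))} {ψ' : Hilb (∀ k, Fin (d k))}
    (h : FullySelfTests B A' ψ') (k : ι) :
    ∀ (Ik : Type) (Ir : {j // j ≠ k} → Type) (Ak : OpSystem (L k) Ik)
      (Ar : ∀ j : {j // j ≠ k}, OpSystem (L j) (Ir j)),
      IsPOVM Ak → (∀ j, IsPOVM (Ar j)) → ∀ ψ : Hilb (Ik × ∀ j, Ir j), ‖ψ‖ = 1 →
      (inner ℂ ψ (splitBellOp k B Ak Ar ψ)).re = 1 →
      ∃ W : Hilb (Fin (d k) × ∀ j : {j // j ≠ k}, Fin (d j)) →ₗᵢ[ℂ] Hilb (Ik × ∀ j, Ir j),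
        W (reindexOp (Equiv.piSplitAt k fun j => Fin (d j)) ψ') = ψ ∧
        Intertwines (bipartiteOps Ak (localOps Ar))
          (bipartiteOps (A' k) (localOps fun j : {j // j ≠ k} => A' j))
          W.toContinuousLinearMap := by
  refine split_induction k fun I A hk hr ψ hψ hv => ?_
  obtain ⟨ψ, rfl⟩ := (reindex (Equiv.piSplitAt k I)).surjective ψ
  rw [LinearIsometryEquiv.norm_map] at hψ
  have hval := inner_splitBellOp_reindexOp k B A ψ
  obtain ⟨W, hWψ, hW⟩ := h.exists_linearIsometry (forall_of_split hk hr) hψ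
    ((congrArg Complex.re hval).symm.trans hv)
  let e' := reindex (Equiv.piSplitAt k fun j => Fin (d j))
  refine ⟨(reindex (Equiv.piSplitAt k I)).toLinearIsometry.comp
    (W.comp e'.symm.toLinearIsometry), ?_, ?_⟩
  · change reindex _ (W (e'.symm (e' ψ'))) = _
    rw [e'.symm_apply_apply, hWψ]
  · exact (intertwines_reindexOp_piSplitAt k A).comp (Intertwines.comp
      (fun p => hW (splitEvent L k p))
      (Intertwines.symm (e := e'.toContinuousLinearEquiv) (intertwines_reindexOp_piSplitAt k A')))

end Split

/-! ### Local isometries from intertwiners -/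

section MatrixUnit

variable {I : Type}

/-- The operator `|a⟩⟨b|`. -/
noncomputable def matrixUnit (a b : I) : Op I I :=
  (innerSL ℂ (ket b)).smulRight (ket a)

theorem matrixUnit_apply (a b : I) (f : Hilb I) : matrixUnit a b f = f b • ket a := by
  rw [matrixUnit, ContinuousLinearMap.smulRight_apply, innerSL_apply_apply, inner_ket_left]

theorem matrixUnit_ket_apply [DecidableEq I] (a b i j : I) :
    matrixUnit a b (ket i) j = if j = a ∧ i = b then 1 else 0 := by
  rw [matrixUnit_apply, lp.coeFn_smul, Pi.smul_apply, ket_apply, ket_apply, smul_eq_mul,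
    ite_and, mul_comm]
  simp only [ite_mul, one_mul, zero_mul, eq_comm]

theorem adjoint_matrixUnit (a b : I) : ContinuousLinearMap.adjoint (matrixUnit a b)
    = matrixUnit b a := by
  classical
  refine op_ext fun i j => ?_
  simp only [adjoint_ket_apply, matrixUnit_ket_apply, and_comm]
  split_ifs <;> simp

theorem sum_matrixUnit_comp [Fintype I] (a : I) :
    ∑ i, matrixUnit i a ∘L matrixUnit a i = 1 := by
  ext1 f
  simp only [sum_apply, ContinuousLinearMap.comp_apply, matrixUnit_apply, lp.coeFn_smul,
    Pi.smul_apply, ket_self, smul_eq_mul, mul_one, sum_ket, one_apply_eq_self]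

theorem tensorOp_matrixUnit {ι : Type} [Fintype ι] {I : ι → Type} (a b : ∀ k, I k) :
    tensorOp (fun k => matrixUnit (a k) (b k)) = matrixUnit a b := by
  classical
  refine op_ext fun i j => ?_
  simp only [tensorOp_ket, matrixUnit_ket_apply, Finset.prod_ite_zero, Finset.mem_univ,
    true_imp_iff, Finset.prod_const_one, funext_iff, forall_and]

end MatrixUnit

section Column

variable {F I J : Type} [Fintype F]

/-- The operator `v ↦ ∑ i, |i⟩ ⊗ Y i v`. -/
noncomputable def columnOp (Y : F → Op I J) : Op I (F × J) :=
  ∑ i, embedOp (.sectR i J) ∘L Y i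

theorem restrictOp_sectR_comp_columnOp (Y : F → Op I J) (i : F) :
    restrictOp (.sectR i J) ∘L columnOp Y = Y i := by
  rw [columnOp, ContinuousLinearMap.comp_finsetSum, Finset.sum_eq_single i]
  · rw [← ContinuousLinearMap.comp_assoc, restrictOp_comp_embedOp]
    rfl
  · intro l _ hl
    rw [← ContinuousLinearMap.comp_assoc, restrictOp_comp_embedOp_of_disjoint,
      ContinuousLinearMap.zero_comp]
    exact fun _ _ h => hl (congrArg Prod.fst h).symm
  · exact fun h => absurd (Finset.mem_univ i) h

theorem adjoint_columnOp_comp_columnOp (Y : F → Op I J) :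
    ContinuousLinearMap.adjoint (columnOp Y) ∘L columnOp Y = ∑ i, ((Y i)†) ∘L Y i := by
  have hadj : ContinuousLinearMap.adjoint (columnOp Y)
      = ∑ i, ((Y i)†) ∘L restrictOp (.sectR i J) := by
    simp only [columnOp, map_sum, ContinuousLinearMap.adjoint_comp, adjoint_embedOp]
  rw [hadj, ContinuousLinearMap.finsetSum_comp]
  simp only [ContinuousLinearMap.comp_assoc, restrictOp_sectR_comp_columnOp]

/-- The second summand of `I ⊕ I` leaves room for an isometry orthogonal to the column. -/
theorem exists_linearIsometry_eqOn_columnOp (a : F) (Y : F → Op I I) :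
    ∃ U : Hilb I →ₗᵢ[ℂ] Hilb (F × (I ⊕ I)),
      Set.EqOn U (columnOp fun i => embedOp .inl ∘L Y i)
        (LinearMap.ker (∑ i, ((Y i)†) ∘L Y i - 1 : Op I I).toLinearMap) := by
  set Q := columnOp fun i => embedOp (Function.Embedding.inl (β := I)) ∘L Y i
  have hQQ : (Q†) ∘L Q = ∑ i, ((Y i)†) ∘L Y i := by
    rw [adjoint_columnOp_comp_columnOp]
    refine Finset.sum_congr rfl fun i _ => ?_
    rw [ContinuousLinearMap.adjoint_comp, adjoint_embedOp, ContinuousLinearMap.comp_assoc,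
      ← ContinuousLinearMap.comp_assoc (restrictOp _), restrictOp_comp_embedOp]
    rfl
  let j : I ↪ F × (I ⊕ I) := Function.Embedding.inr.trans (.sectR a _)
  have hjQ : restrictOp j ∘L Q = 0 := by
    change restrictOp .inr ∘L restrictOp (.sectR a _) ∘L Q = 0
    rw [restrictOp_sectR_comp_columnOp, ← ContinuousLinearMap.comp_assoc,
      restrictOp_comp_embedOp_of_disjoint fun _ _ => Sum.inr_ne_inl,
      ContinuousLinearMap.zero_comp]
  have : CompleteSpace (LinearMap.ker (∑ i, ((Y i)†) ∘L Y i - 1 : Op I I).toLinearMap) :=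
    (ContinuousLinearMap.isClosed_ker _).completeSpace_coe
  refine exists_linearIsometry_eqOn _ Q ⟨(embedOp j).toLinearMap, norm_embedOp j⟩ ?_ fun v w => ?_
  · intro v hv
    have hQv : (Q†) (Q v) = v := by
      rw [← ContinuousLinearMap.comp_apply, hQQ]
      exact sub_eq_zero.1 hv
    refine (pow_left_inj₀ (norm_nonneg _) (norm_nonneg _) two_ne_zero).1 ?_
    rw [← inner_self_eq_norm_sq (𝕜 := ℂ), ← inner_self_eq_norm_sq (𝕜 := ℂ),
      ← ContinuousLinearMap.adjoint_inner_right, hQv]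
  · change inner ℂ (Q v) (embedOp j w) = 0
    rw [embedOp, ContinuousLinearMap.adjoint_inner_right, ← ContinuousLinearMap.comp_apply, hjQ,
      zero_apply, inner_zero_left]

end Column

theorem ampl_starProjection_ker {I K : Type} (T : Op I I) {w : Hilb (I × K)}
    (hw : ampl K T w = 0) : ampl K (LinearMap.ker T.toLinearMap).starProjection w = w := by
  refine lp.ext (funext fun p => ?_)
  have hker : slice w p.2 ∈ LinearMap.ker T.toLinearMap :=
    congrArg (restrictOp (.sectL I p.2)) hw
  rw [ampl_apply, Submodule.starProjection_eq_self_iff.2 hker]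
  rfl

section Local

variable {ι : Type} [Fintype ι] {I J : ι → Type}

theorem localOp_starProjection_ker [DecidableEq ι] (k : ι) (T : Op (I k) (I k)) {N : Type}
    {W : Op N (∀ k, I k)} (hW : localOp k T ∘L W = 0) :
    localOp k (LinearMap.ker T.toLinearMap).starProjection ∘L W = W := by
  have hcomp := fun S : Op (I k) (I k) => reindexOp_piSplitAt_comp_localOp_self k S
  ext1 v
  refine (reindex (Equiv.piSplitAt k I)).injective ?_
  change (reindexOp _ ∘L localOp k _) (W v) = reindexOp _ (W v)
  rw [hcomp]
  refine ampl_starProjection_ker T ?_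
  change (ampl _ T ∘L reindexOp _) (W v) = 0
  rw [← hcomp]
  change reindexOp _ ((localOp k T ∘L W) v) = 0
  rw [hW, zero_apply, map_zero]

theorem tensorOp_comp_eq_of_eqOn [DecidableEq ι] {U Q : ∀ k, Op (I k) (J k)}
    (p : ∀ k, Submodule ℂ (Hilb (I k))) [∀ k, (p k).HasOrthogonalProjection]
    (hUQ : ∀ k, Set.EqOn (U k) (Q k) (p k)) {M : ι → Type} {W : Op (∀ k, M k) (∀ k, I k)}
    (hp : ∀ k, localOp k (p k).starProjection ∘L W = W) :
    tensorOp U ∘L W = tensorOp Q ∘L W := by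
  have hW : tensorOp (fun k => (p k).starProjection) ∘L W = W := by
    rw [tensorOp_comp_of_intertwines (T := fun k => (1 : Op (M k) (M k))) fun k => ?_, tensorOp_one]
    · rfl
    · exact (hp k).trans (congrArg (W ∘L ·) (localOp_one k)).symm
  have hcomp : ∀ k, U k ∘L (p k).starProjection = Q k ∘L (p k).starProjection := fun k =>
    ContinuousLinearMap.ext fun v => hUQ k ((p k).starProjection_apply_mem v)
  rw [← hW, ← ContinuousLinearMap.comp_assoc, ← ContinuousLinearMap.comp_assoc, tensorOp_comp,
    tensorOp_comp, funext hcomp]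

variable {d : ι → ℕ} {L : ι → Leg} {A' : ∀ k, OpSystem (L k) (Fin (d k))}
  {A : ∀ k, OpSystem (L k) (I k)} [DecidableEq ι] {W : Op (∀ k, Fin (d k)) (∀ k, I k)}

theorem exists_localOp_comp_eq (hA' : ∀ k, IsPOVM (A' k)) (hA : ∀ k, IsPOVM (A k))
    (hW : Intertwines (localOps A) (localOps A') W) {k : ι} {X : Op (Fin (d k)) (Fin (d k))}
    (hX : X ∈ Algebra.adjoin ℂ (Set.range (A' k))) :
    ∃ Y : Op (I k) (I k), localOp k Y ∘L W = W ∘L localOp k X ∧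
      localOp k (Y†) ∘L W = W ∘L localOp k (X†) := by
  have hWk : Intertwines (localOpHom I k ∘ A k) (localOpHom (fun k => Fin (d k)) k ∘ A' k) W :=
    fun e => hW ⟨k, e⟩
  obtain ⟨Y, h, h'⟩ := exists_intertwined_of_mem_adjoin (localOpHom (fun k => Fin (d k)) k)
    (localOpHom I k) (hA' k).isSelfAdjoint (hA k).isSelfAdjoint hWk hX
  exact ⟨Y, h, h'⟩

theorem localOp_sum_adjoint_comp {k : ι} {a : Fin (d k)} {Y : Fin (d k) → Op (I k) (I k)}
    (hY : ∀ i, localOp k (Y i) ∘L W = W ∘L localOp k (matrixUnit a i))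
    (hY' : ∀ i, localOp k ((Y i)†) ∘L W = W ∘L localOp k ((matrixUnit a i)†)) :
    localOp k (∑ i, ((Y i)†) ∘L Y i) ∘L W = W := by
  have hYY : ∀ i, localOp k (((Y i)†) ∘L Y i) ∘L W
      = W ∘L localOp k (matrixUnit i a ∘L matrixUnit a i) := fun i => by
    rw [← localOp_comp, ContinuousLinearMap.comp_assoc, hY, ← ContinuousLinearMap.comp_assoc, hY',
      ContinuousLinearMap.comp_assoc, localOp_comp, adjoint_matrixUnit]
  rw [← localOpHom_apply, map_sum, ContinuousLinearMap.finsetSum_comp]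
  simp only [localOpHom_apply, hYY]
  rw [← ContinuousLinearMap.comp_finsetSum]
  simp only [← localOpHom_apply]
  rw [← map_sum, sum_matrixUnit_comp, map_one]
  rfl

/-- The lifts `Y k i` of the matrix units `|a k⟩⟨i|` assemble to the column `∑ i, |i⟩ ⊗ Y k i`,
which is isometric on the local support of the range of `W`; the junk state is the image of `a`. -/
theorem exists_local_isometries {W : Hilb (∀ k, Fin (d k)) →ₗᵢ[ℂ] Hilb (∀ k, I k)}
    (hA' : ∀ k, IsPOVM (A' k)) (hA : ∀ k, IsPOVM (A k))
    (htop : ∀ k, Algebra.adjoin ℂ (Set.range (A' k)) = ⊤) (a : ∀ k, Fin (d k))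
    (hW : Intertwines (localOps A) (localOps A') W.toContinuousLinearMap) :
    ∃ (K : ι → Type) (junk : Hilb (∀ k, K k))
      (U : ∀ k, Hilb (I k) →ₗᵢ[ℂ] Hilb (Fin (d k) × K k)), ‖junk‖ = 1 ∧
      ∀ (φ : Hilb (∀ k, Fin (d k))) (f : ∀ k, Fin (d k) × K k),
        tensorOp (fun k => (U k).toContinuousLinearMap) (W φ) f
          = φ (fun k => (f k).1) * junk (fun k => (f k).2) := by
  have hlift := fun k i => exists_localOp_comp_eq hA' hA hW (k := k) (X := matrixUnit (a k) i)
    (by rw [htop k]; trivial)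
  choose Y hY hY' using hlift
  choose U hU using fun k => exists_linearIsometry_eqOn_columnOp (a k) (Y k)
  have hUW := tensorOp_comp_eq_of_eqOn (U := fun k => (U k).toContinuousLinearMap)
      (W := W.toContinuousLinearMap) _ hU fun k => localOp_starProjection_ker k _ <| by
    rw [← localOpHom_apply, map_sub, map_one, ContinuousLinearMap.sub_comp, localOpHom_apply,
      localOp_sum_adjoint_comp (hY k) (hY' k)]
    exact sub_self _
  have hYW : ∀ (i : ∀ k, Fin (d k)) φ,
      tensorOp (fun k => Y k (i k)) (W φ) = φ i • W (ket a) := fun i φ => by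
    have := DFunLike.congr_fun (tensorOp_comp_of_intertwines fun k => hY k (i k)) φ
    rw [tensorOp_matrixUnit] at this
    rw [← map_smul, ← matrixUnit_apply]
    exact this
  let inl := fun k => (embedOp .inl : Op (I k) (I k ⊕ I k))
  refine ⟨fun k => I k ⊕ I k, tensorOp inl (W (ket a)), U, ?_, fun φ f => ?_⟩
  · have hinl := norm_tensorOp_linearIsometry (fun k => ⟨(inl k).toLinearMap, norm_embedOp _⟩)
      (W (ket a))
    rw [W.norm_map, orthonormal_ket.norm_eq_one] at hinl
    exact hinl
  · let i := fun k => (f k).1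
    calc tensorOp (fun k => (U k).toContinuousLinearMap) (W φ) f
      _ = restrictOp (.piCongrRight fun k => .sectR (i k) _)
            (tensorOp (fun k => columnOp fun i => embedOp .inl ∘L Y k i) (W φ))
            (fun k => (f k).2) := congrArg (fun v => v f) (DFunLike.congr_fun hUW φ)
      _ = tensorOp (fun k => inl k ∘L Y k (i k)) (W φ) (fun k => (f k).2) := by
        rw [← tensorOp_restrictOp, ← ContinuousLinearMap.comp_apply, tensorOp_comp]
        simp only [restrictOp_sectR_comp_columnOp]
        rfl
      _ = φ i * tensorOp inl (W (ket a)) (fun k => (f k).2) := by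
        rw [← tensorOp_comp, ContinuousLinearMap.comp_apply, hYW, map_smul]
        rfl

theorem fullySelfTests_of_forall_exists_linearIsometry {B : BellFunctional L}
    {ψ' : Hilb (∀ k, Fin (d k))} (proj : ∀ k, IsProjective (A' k)) (hψ' : ‖ψ'‖ = 1)
    (cyclic : cyclicSubspace (localOps A') ψ' = ⊤) (normalized : IsNormalized B)
    (htop : ∀ k, Algebra.adjoin ℂ (Set.range (A' k)) = ⊤)
    (hself : ∀ (I : ι → Type) (A : ∀ k, OpSystem (L k) (I k)) (ψ : Hilb (∀ k, I k)),
      (∀ k, IsPOVM (A k)) → ‖ψ‖ = 1 → (inner ℂ ψ (bellOp B A ψ)).re = 1 →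
      ∃ W : Hilb (∀ k, Fin (d k)) →ₗᵢ[ℂ] Hilb (∀ k, I k), W ψ' = ψ ∧
        Intertwines (localOps A) (localOps A') W.toContinuousLinearMap) :
    FullySelfTests B A' ψ' where
  projective := proj
  norm_state := hψ'
  cyclic := by
    rw [tensorPolynomials_eq_adjoin, ← coe_cyclicSubspace, cyclic, Submodule.top_coe]
  normalized := normalized
  self_test I A ψ hA hψ hv := by
    obtain ⟨W, rfl, hW⟩ := hself I A ψ hA hψ hv
    obtain ⟨a⟩ := nonempty_of_norm_eq_one hψ'
    obtain ⟨K, junk, U, hjunk, hU⟩ :=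
      exists_local_isometries (fun k => (proj k).1) hA htop a hW
    refine ⟨fun k => ketBasis (Fin (d k)), fun i => W (ket i),
      orthonormal_ket.comp_linearIsometry W, ?_, K, junk, U, hjunk, fun e i f => ?_⟩
    · conv_lhs => rw [← sum_ket ψ']
      simp only [ketBasis_apply, prodVec_ket, inner_ket_left, map_sum, map_smul]
    · have hAW := DFunLike.congr_fun (tensorOp_comp_of_intertwines fun k => hW ⟨k, e k⟩) (ket i)
      simp only [ketBasis_apply, prodVec_ket]
      rw [← hU]
      exact congrArg (fun v => tensorOp (fun k => (U k).toContinuousLinearMap) v f) hAW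

end Local

/-! ### Self-testing in the presence of a further system -/

section Slices

variable {I J K N R : Type}

theorem op_ext_restrictOp_sectL {X Y : Op N (J × R)}
    (h : ∀ r, restrictOp (.sectL J r) ∘L X = restrictOp (.sectL J r) ∘L Y) : X = Y := by
  ext1 v
  refine lp.ext (funext fun p => ?_)
  exact congrArg (fun f : Hilb J => f p.1) (DFunLike.congr_fun (h p.2) v)

theorem op_ext_embedOp_sectL {X Y : Op (I × K) N}
    (h : ∀ c, X ∘L embedOp (.sectL I c) = Y ∘L embedOp (.sectL I c)) : X = Y :=
  map_ext_ket fun p => by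
    have := DFunLike.congr_fun (h p.2) (ket p.1)
    rwa [ContinuousLinearMap.comp_apply, ContinuousLinearMap.comp_apply, embedOp_ket] at this

theorem exists_restrictOp_sectL_comp_eq [Finite N] (T : R → Op N J)
    (hT : ∀ v, Summable fun r => ‖T r v‖ ^ 2) :
    ∃ T' : Op N (J × R), ∀ r, restrictOp (.sectL J r) ∘L T' = T r := by
  have hsum : ∀ v, Summable fun p : J × R => ‖T p.2 v p.1‖ ^ 2 := by
    intro v
    rw [← (Equiv.prodComm R J).summable_iff]
    refine (summable_prod_of_nonneg fun p => sq_nonneg _).2 ⟨fun r => hilb_summable (T r v), ?_⟩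
    exact (hT v).congr fun r => hilb_norm_sq (T r v)
  let T' : Hilb N →ₗ[ℂ] Hilb (J × R) :=
    { toFun := fun v => ⟨fun p => T p.2 v p.1, memHilb (hsum v)⟩
      map_add' := fun v w => lp.ext <| funext fun p =>
        congrArg (fun f : Hilb J => f p.1) ((T p.2).map_add v w)
      map_smul' := fun c v => lp.ext <| funext fun p =>
        congrArg (fun f : Hilb J => f p.1) ((T p.2).map_smul c v) }
  exact ⟨LinearMap.toContinuousLinearMap T', fun r => rfl⟩

variable [Fintype K]

/-- The row `∑ c, T c ⊗ ⟨c|` with the operators `T c` as its entries. -/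
noncomputable def rowOp (T : K → Op I N) : Op (I × K) N :=
  ∑ c, T c ∘L restrictOp (.sectL I c)

theorem rowOp_comp_embedOp_sectL (T : K → Op I N) (c : K) :
    rowOp T ∘L embedOp (.sectL I c) = T c := by
  rw [rowOp, ContinuousLinearMap.finsetSum_comp, Finset.sum_eq_single c]
  · rw [ContinuousLinearMap.comp_assoc, restrictOp_comp_embedOp]
    rfl
  · intro d _ hd
    rw [ContinuousLinearMap.comp_assoc, restrictOp_comp_embedOp_of_disjoint,
      ContinuousLinearMap.comp_zero]
    exact fun _ _ h => hd (congrArg Prod.snd h)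
  · exact fun h => absurd (Finset.mem_univ c) h

theorem rowOp_comp_ampl (T : K → Op J N) (X : Op I J) :
    rowOp T ∘L ampl K X = rowOp fun c => T c ∘L X :=
  op_ext_embedOp_sectL fun c => by
    rw [ContinuousLinearMap.comp_assoc, ampl_comp_embedOp_sectL, ← ContinuousLinearMap.comp_assoc,
      rowOp_comp_embedOp_sectL, rowOp_comp_embedOp_sectL]

theorem rowOp_comp_embedOp_eq (W : Op (I × K) N) :
    rowOp (fun c => W ∘L embedOp (.sectL I c)) = W :=
  op_ext_embedOp_sectL fun c => rowOp_comp_embedOp_sectL _ c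

theorem comp_rowOp {M : Type} (G : Op N M) (T : K → Op I N) :
    G ∘L rowOp T = rowOp fun c => G ∘L T c :=
  op_ext_embedOp_sectL fun c => by
    rw [ContinuousLinearMap.comp_assoc, rowOp_comp_embedOp_sectL, rowOp_comp_embedOp_sectL]

theorem norm_rowOp_apply [DecidableEq K] {T : K → Op I N}
    (hT : ∀ c d, ((T c)†) ∘L T d = if c = d then 1 else 0) (v : Hilb (I × K)) :
    ‖rowOp T v‖ = ‖v‖ := by
  refine (ContinuousLinearMap.norm_map_iff_adjoint_comp_self _).2 ?_ v
  refine op_ext_embedOp_sectL fun d => op_ext_restrictOp_sectL fun c => ?_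
  have hadj : restrictOp (.sectL I c) ∘L ((rowOp T)†) = (T c)† := by
    rw [← rowOp_comp_embedOp_sectL T c, ContinuousLinearMap.adjoint_comp, adjoint_embedOp]
  rw [ContinuousLinearMap.comp_assoc, rowOp_comp_embedOp_sectL, ← ContinuousLinearMap.comp_assoc,
    hadj, hT]
  change _ = restrictOp _ ∘L embedOp _
  obtain rfl | hcd := eq_or_ne c d
  · rw [if_pos rfl, restrictOp_comp_embedOp]
  · rw [if_neg hcd, restrictOp_comp_embedOp_of_disjoint]
    exact fun _ _ h => hcd (congrArg Prod.snd h)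

theorem tensorOpProd_one_comp_embedOp_sectL (S : Op K K) (c : K) :
    tensorOpProd (1 : Op I I) S ∘L embedOp (.sectL I c)
      = ∑ d, S (ket c) d • embedOp (.sectL I d) := by
  classical
  refine op_ext fun i p => ?_
  rw [ContinuousLinearMap.comp_apply, embedOp_ket, tensorOpProd_ket, sum_apply, lp.coeFn_sum,
    Finset.sum_apply, Finset.sum_eq_single p.2]
  · rw [smul_apply, embedOp_ket]
    simp [ket_apply, Prod.ext_iff, mul_comm]
  · intro d _ hd
    rw [smul_apply, embedOp_ket, lp.coeFn_smul, Pi.smul_apply, ket_of_ne, smul_zero]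
    exact fun h => hd (congrArg Prod.snd h).symm
  · exact fun h => absurd (Finset.mem_univ _) h

theorem intertwines_rowOp {α β : Type} {S₁ : α → Op J J} {S : β → Op R R} {T₁ : α → Op I I}
    {S' : β → Op K K} {T : K → Op I (J × R)}
    (hT : ∀ c, Intertwines (fun a => ampl R (S₁ a)) T₁ (T c))
    (hTS : ∀ b c, tensorOpProd 1 (S b) ∘L T c = ∑ d, S' b (ket c) d • T d) :
    Intertwines (bipartiteOps S₁ S) (bipartiteOps T₁ S') (rowOp T) := by
  rintro (a | b)
  · change ampl R (S₁ a) ∘L rowOp T = rowOp T ∘L ampl K (T₁ a)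
    rw [comp_rowOp, rowOp_comp_ampl]
    exact congrArg rowOp (funext fun c => hT c a)
  · change tensorOpProd 1 (S b) ∘L rowOp T = rowOp T ∘L tensorOpProd 1 (S' b)
    refine op_ext_embedOp_sectL fun c => ?_
    simp only [ContinuousLinearMap.comp_assoc, rowOp_comp_embedOp_sectL, hTS,
      tensorOpProd_one_comp_embedOp_sectL, ContinuousLinearMap.comp_finsetSum,
      ContinuousLinearMap.comp_smul]

end Slices

section Extension

variable {ι : Type} [Fintype ι] [DecidableEq ι] {L : ι → Leg} {I : ι → Type}
  {A : ∀ k, OpSystem (L k) (I k)} {d : ι → ℕ} {A' : ∀ k, OpSystem (L k) (Fin (d k))}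
  {ψ' : Hilb (∀ k, Fin (d k))} {R : Type}

theorem FullySelfTests.exists_intertwiner_of_ampl_bellOp_apply_eq {B : BellFunctional L}
    (h : FullySelfTests B A' ψ') (hA : ∀ k, IsPOVM (A k)) {w : Hilb ((∀ k, I k) × R)}
    (hw : ampl R (bellOp B A) w = w) :
    ∃ T : Op (∀ k, Fin (d k)) ((∀ k, I k) × R), T ψ' = w ∧
      Intertwines (fun p => ampl R (localOps A p)) (localOps A') T := by
  have hslice : ∀ r, bellOp B A (slice w r) = slice w r := fun r =>
    congrArg (fun v => slice v r) hw
  choose T hTψ hT hnorm using fun r => h.exists_intertwiner_of_bellOp_apply_eq hA (hslice r)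
  obtain ⟨T', hT'⟩ := exists_restrictOp_sectL_comp_eq T fun v => by
    simp only [hnorm, mul_pow]
    exact (slice_hasSum w).summable.mul_right _
  refine ⟨T', lp.ext (funext fun p => ?_), fun p => op_ext_restrictOp_sectL fun r => ?_⟩
  · change (restrictOp (.sectL _ p.2) ∘L T') ψ' p.1 = w p
    rw [hT', hTψ]
    rfl
  · rw [← ContinuousLinearMap.comp_assoc, restrictOp_sectL_comp_ampl,
      ContinuousLinearMap.comp_assoc, hT', hT r p, ← ContinuousLinearMap.comp_assoc, hT']

theorem FullySelfTests.adjoint_comp_eq_inner_smul_one {B : BellFunctional L}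
    (h : FullySelfTests B A' ψ') {F : Type*} [NormedAddCommGroup F] [InnerProductSpace ℂ F]
    [CompleteSpace F] {S : (Σ k, (L k).Event) → F →L[ℂ] F} (hS : ∀ p, IsSelfAdjoint (S p))
    {X Y : Hilb (∀ k, Fin (d k)) →L[ℂ] F} (hX : Intertwines S (localOps A') X)
    (hY : Intertwines S (localOps A') Y) :
    (X†) ∘L Y = (inner ℂ (X ψ') (Y ψ') : ℂ) • 1 := by
  obtain ⟨z, hz⟩ := h.exists_eq_smul_one_of_intertwines
    ((hX.adjoint hS (isSelfAdjoint_localOps h.isPOVM)).comp hY)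
  suffices inner ℂ (X ψ') (Y ψ') = z by rw [hz, this]
  rw [← ContinuousLinearMap.adjoint_inner_right, ← ContinuousLinearMap.comp_apply, hz,
    smul_apply, inner_smul_right, one_apply_eq_self, inner_self_eq_norm_sq_to_K, h.norm_state]
  simp

variable {out : Leg} {C : ConnTensor L out} {μ : out.Event → ℝ}

theorem bellOp_sum_mul (C : ConnTensor L out) (μ : out.Event → ℝ)
    (A : ∀ k, OpSystem (L k) (I k)) :
    bellOp (fun e => ∑ o, μ o * C o e) A = ∑ o, (μ o : ℂ) • connOp C A o := by
  simp only [connOp, bellOp, Finset.smul_sum, smul_smul, Complex.ofReal_sum, Complex.ofReal_mul,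
    Finset.sum_smul]
  exact Finset.sum_comm

theorem intertwines_ampl_connOp {J : ι → Type}
    {D : ∀ k, OpSystem (L k) (J k)} {W : Op (∀ k, J k) ((∀ k, I k) × R)}
    (h : Intertwines (fun p => ampl R (localOps A p)) (localOps D) W) :
    Intertwines (fun o => ampl R (connOp C A o)) (connOp C D) W := fun o =>
  map_bellOp_comp_of_intertwines (amplHom (∀ k, I k) R).toAlgHom h (C o)

variable {O : Type} {J : Hilb O →ₗᵢ[ℂ] Hilb (∀ k, Fin (d k))} {M : OpSystem out O} {χ : Hilb O}

theorem FullySelfTests.sum_smul_apply_eq (h : FullySelfTests (fun e => ∑ o, μ o * C o e) A' ψ')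
    (hJ : Intertwines (connOp C A') M J.toContinuousLinearMap) (hχ : J χ = ψ') :
    (∑ o, (μ o : ℂ) • M o) χ = χ := by
  refine J.injective ?_
  conv_rhs => rw [hχ, ← h.bellOp_apply_state, bellOp_sum_mul, ← hχ]
  simp only [sum_apply, smul_apply, map_sum, map_smul]
  exact Finset.sum_congr rfl fun o _ => congrArg _ (hJ.apply o χ).symm

theorem FullySelfTests.exists_intertwiner_comp_eq
    (h : FullySelfTests (fun e => ∑ o, μ o * C o e) A' ψ')
    (hJ : Intertwines (connOp C A') M J.toContinuousLinearMap) (hχ : J χ = ψ')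
    (hcyc : cyclicSubspace M χ = ⊤) (hA : ∀ k, IsPOVM (A k)) {Z : Op O ((∀ k, I k) × R)}
    (hZ : Intertwines (fun o => ampl R (connOp C A o)) M Z) :
    ∃ T : Op (∀ k, Fin (d k)) ((∀ k, I k) × R), T ∘L J.toContinuousLinearMap = Z ∧
      Intertwines (fun p => ampl R (localOps A p)) (localOps A') T := by
  have hfix : ampl R (bellOp (fun e => ∑ o, μ o * C o e) A) (Z χ) = Z χ := by
    conv_rhs => rw [← h.sum_smul_apply_eq hJ hχ]
    change amplHom _ R _ _ = _
    simp only [bellOp_sum_mul, map_sum, map_smul, sum_apply, smul_apply]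
    exact Finset.sum_congr rfl fun o _ => congrArg _ (hZ.apply o χ)
  obtain ⟨T, hTψ, hT⟩ := h.exists_intertwiner_of_ampl_bellOp_apply_eq hA hfix
  refine ⟨T, ContinuousLinearMap.ext fun v => ?_, hT⟩
  have hψ : (T ∘L J.toContinuousLinearMap) χ = Z χ := (congrArg T hχ).trans hTψ
  exact ((intertwines_ampl_connOp hT).comp hJ).eqOn_cyclicSubspace hZ hψ (hcyc ▸ Submodule.mem_top)

theorem inner_embedOp_sectL [DecidableEq R] {N : Type} (ρ σ : R) (v w : Hilb N) :
    inner ℂ (embedOp (.sectL N ρ) v) (embedOp (.sectL N σ) w)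
      = if ρ = σ then inner ℂ v w else 0 := by
  rw [embedOp, ContinuousLinearMap.adjoint_inner_left, ← ContinuousLinearMap.comp_apply]
  obtain rfl | h := eq_or_ne ρ σ
  · rw [if_pos rfl, restrictOp_comp_embedOp]
    rfl
  · rw [if_neg h, restrictOp_comp_embedOp_of_disjoint, zero_apply, inner_zero_right]
    exact fun _ _ hp => h (congrArg Prod.snd hp)

/-- On each basis vector `ρ` of `ℓ²(R')`, the self-test extends `W₂ (· ⊗ ρ)` along `J`; by
irreducibility the extensions have the Gram matrix of the basis, so they form an isometry. -/
theorem FullySelfTests.exists_linearIsometry_extension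
    (h : FullySelfTests (fun e => ∑ o, μ o * C o e) A' ψ')
    (hJ : Intertwines (connOp C A') M J.toContinuousLinearMap) (hχ : J χ = ψ')
    (hcyc : cyclicSubspace M χ = ⊤) (hA : ∀ k, IsPOVM (A k)) {R' β : Type} [Finite R']
    {S : β → Op R R} {S' : β → Op R' R'} (W₂ : Hilb (O × R') →ₗᵢ[ℂ] Hilb ((∀ k, I k) × R))
    (hW₂ : Intertwines (bipartiteOps (connOp C A) S) (bipartiteOps M S')
      W₂.toContinuousLinearMap) :
    ∃ W : Hilb ((∀ k, Fin (d k)) × R') →ₗᵢ[ℂ] Hilb ((∀ k, I k) × R),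
      W.toContinuousLinearMap ∘L ampl R' J.toContinuousLinearMap = W₂.toContinuousLinearMap ∧
      Intertwines (bipartiteOps (localOps A) S) (bipartiteOps (localOps A') S')
        W.toContinuousLinearMap := by
  classical
  cases nonempty_fintype R'
  have hZ : ∀ ρ, Intertwines (fun o => ampl R (connOp C A o)) M
      (W₂.toContinuousLinearMap ∘L embedOp (.sectL O ρ)) := fun ρ =>
    Intertwines.comp (fun o => hW₂ (.inl o)) fun o => ampl_comp_embedOp_sectL ρ (M o)
  choose T hTJ hT using fun ρ => h.exists_intertwiner_comp_eq hJ hχ hcyc hA (hZ ρ)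
  have hTψ : ∀ ρ, T ρ ψ' = W₂ (embedOp (.sectL O ρ) χ) := fun ρ =>
    hχ ▸ DFunLike.congr_fun (hTJ ρ) χ
  have hχ_norm : ‖χ‖ = 1 := by rw [← J.norm_map, hχ, h.norm_state]
  have hGram : ∀ ρ σ, ((T ρ)†) ∘L T σ = if ρ = σ then 1 else 0 := fun ρ σ => by
    rw [h.adjoint_comp_eq_inner_smul_one
      (fun p => (isSelfAdjoint_localOps hA p).map (amplHom _ R)) (hT ρ) (hT σ), hTψ, hTψ,
      W₂.inner_map_map, inner_embedOp_sectL, inner_self_eq_norm_sq_to_K, hχ_norm]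
    split_ifs <;> simp
  have hTS : ∀ b ρ, tensorOpProd 1 (S b) ∘L T ρ = ∑ σ, S' b (ket ρ) σ • T σ := fun b ρ => by
    refine h.eq_of_intertwines (S := fun p => ampl R (localOps A p)) (fun p => ?_) (fun p => ?_) ?_
    · rw [← ContinuousLinearMap.comp_assoc, ampl_comp_tensorOpProd_one,
        ContinuousLinearMap.comp_assoc, hT ρ p, ContinuousLinearMap.comp_assoc]
    · rw [ContinuousLinearMap.comp_finsetSum, ContinuousLinearMap.finsetSum_comp]
      exact Finset.sum_congr rfl fun σ _ => (hT σ).smul _ p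
    · have := DFunLike.congr_fun (hW₂ (.inr b)) (embedOp (.sectL O ρ) χ)
      change tensorOpProd 1 (S b) (W₂ _) = W₂ ((tensorOpProd 1 (S' b) ∘L _) χ) at this
      rw [ContinuousLinearMap.comp_apply, hTψ, this, tensorOpProd_one_comp_embedOp_sectL]
      simp only [sum_apply, smul_apply, map_sum, map_smul, hTψ]
  refine ⟨⟨(rowOp T).toLinearMap, norm_rowOp_apply hGram⟩, ?_, intertwines_rowOp hT hTS⟩
  · change rowOp T ∘L ampl R' J.toContinuousLinearMap = _
    rw [rowOp_comp_ampl, funext hTJ, rowOp_comp_embedOp_eq]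

end Extension

/-! ### Contractions of fully self-testing complexes -/

section Contraction

theorem reindexOp_sumPi_comp_bellOp {α β : Type} [Fintype α] [DecidableEq α] [Fintype β]
    [DecidableEq β] {L : α ⊕ β → Leg} (B : BellFunctional L) {I : α ⊕ β → Type}
    (A : ∀ j, OpSystem (L j) (I j)) :
    reindexOp (Equiv.sumPiEquivProdPi I) ∘L bellOp B A
      = (∑ p : (∀ a, (L (.inl a)).Event) × ∀ b, (L (.inr b)).Event,
          (B ((Equiv.sumPiEquivProdPi fun j => (L j).Event).symm p) : ℂ) •
            tensorOpProd (tensorOp fun a => A (.inl a) (p.1 a))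
              (tensorOp fun b => A (.inr b) (p.2 b))) ∘L
        reindexOp (Equiv.sumPiEquivProdPi I) := by
  rw [bellOp, ContinuousLinearMap.finsetSum_comp, ContinuousLinearMap.comp_finsetSum]
  refine Fintype.sum_equiv (Equiv.sumPiEquivProdPi fun j => (L j).Event) _ _ fun e => ?_
  rw [ContinuousLinearMap.comp_smul, reindexOp_sumPi_comp_tensorOp, Equiv.symm_apply_apply,
    ContinuousLinearMap.smul_comp]
  rfl

variable {ι₁ ι : Type} [Fintype ι₁] [DecidableEq ι₁] [Fintype ι] [DecidableEq ι]
  {L₁ : ι₁ → Leg} {L : ι → Leg} {k : ι} {Ir : {j // j ≠ k} → Type}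

theorem splitBellOp_connOp (B : BellFunctional L) (C : ConnTensor L₁ (L k))
    {I₁ : ι₁ → Type} (A : ∀ l, OpSystem (L₁ l) (I₁ l))
    (Ar : ∀ j : {j // j ≠ k}, OpSystem (L j) (Ir j)) :
    splitBellOp k B (connOp C A) Ar
      = ∑ p : (∀ l, (L₁ l).Event) × ∀ j : {j // j ≠ k}, (L j).Event,
        ((∑ c, B ((Equiv.piSplitAt k fun j => (L j).Event).symm (c, p.2)) * C c p.1 : ℝ) : ℂ) •
          tensorOpProd (tensorOp fun l => A l (p.1 l)) (tensorOp fun j => Ar j (p.2 j)) := by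
  simp only [splitBellOp, connOp, bellOp, tensorOpProd_sum_left, tensorOpProd_smul_left,
    Finset.smul_sum, smul_smul, Complex.ofReal_sum, Complex.ofReal_mul, Finset.sum_smul]
  rw [Fintype.sum_prod_type_right, Fintype.sum_prod_type_right]
  exact Finset.sum_congr rfl fun _ _ => Finset.sum_comm

theorem splitBellOp_sum_mul {out : Leg} (C : ConnTensor L out) (μ : out.Event → ℝ) {Ik : Type}
    (Ak : OpSystem (L k) Ik) (Ar : ∀ j : {j // j ≠ k}, OpSystem (L j) (Ir j)) :
    splitBellOp k (fun e => ∑ o, μ o * C o e) Ak Ar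
      = ∑ o, (μ o : ℂ) • splitBellOp k (C o) Ak Ar := by
  simp only [splitBellOp, Finset.smul_sum, smul_smul, Complex.ofReal_sum, Complex.ofReal_mul,
    Finset.sum_smul]
  exact Finset.sum_comm

theorem Intertwines.sum_smul {α E F : Type*} [Fintype α] [NormedAddCommGroup E]
    [NormedSpace ℂ E] [NormedAddCommGroup F] [NormedSpace ℂ F] {S : α → F →L[ℂ] F}
    {T : α → E →L[ℂ] E} {W : E →L[ℂ] F} (h : Intertwines S T W) (c : α → ℂ) :
    (∑ a, c a • S a) ∘L W = W ∘L ∑ a, c a • T a := by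
  rw [ContinuousLinearMap.comp_finsetSum, ContinuousLinearMap.finsetSum_comp]
  refine Finset.sum_congr rfl fun a _ => ?_
  rw [ContinuousLinearMap.comp_smul, ContinuousLinearMap.smul_comp, h]

theorem adjoint_reindexOp_symm_comp_ampl_comp_reindexOp {I I' J J' R : Type} (e₁ : I ≃ I' × R)
    (e₂ : J ≃ J' × R) (V : Op I' J') :
    ((reindexOp e₂.symm ∘L ampl R V ∘L reindexOp e₁)†)
      = reindexOp e₁.symm ∘L ampl R (V†) ∘L reindexOp e₂ := by
  rw [ContinuousLinearMap.adjoint_comp, ContinuousLinearMap.adjoint_comp, reindexOp_adjoint,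
    reindexOp_adjoint, ampl_adjoint, Equiv.symm_symm, ContinuousLinearMap.comp_assoc]

theorem reindexOp_symm_comp_ampl_comp_adjoint {I I' J J' R : Type} (e₁ : I ≃ I' × R)
    (e₂ : J ≃ J' × R) {V : Op I' J'} (hV : V ∘L (V†) = 1) :
    (reindexOp e₂.symm ∘L ampl R V ∘L reindexOp e₁)
      ∘L ((reindexOp e₂.symm ∘L ampl R V ∘L reindexOp e₁)†) = 1 := by
  rw [adjoint_reindexOp_symm_comp_ampl_comp_reindexOp]
  ext1 v
  change reindexOp e₂.symm (ampl R V (reindex e₁ ((reindex e₁).symm (ampl R (V†)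
    (reindexOp e₂ v))))) = v
  have h : ampl R V (ampl R (V†) (reindexOp e₂ v)) = reindexOp e₂ v :=
    congrArg (fun T => ampl R T (reindexOp e₂ v)) hV
  rw [LinearIsometryEquiv.apply_symm_apply, h]
  exact (reindex e₂).symm_apply_apply v

end Contraction

section Cyclic

variable {E α : Type*} [NormedAddCommGroup E] [NormedSpace ℂ E]

theorem map_mem_cyclicSubspace_of_mem_adjoin {T : α → E →L[ℂ] E} {f : E →L[ℂ] E}
    (hf : f ∈ Algebra.adjoin ℂ (Set.range T)) {ψ v : E} (hv : v ∈ cyclicSubspace T ψ) :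
    f v ∈ cyclicSubspace T ψ := by
  obtain ⟨g, hg, rfl⟩ := hv
  exact ⟨f * g, (Algebra.adjoin ℂ (Set.range T)).mul_mem hf hg, rfl⟩

theorem tensorOp_mem_adjoin {ι : Type} [Fintype ι] [DecidableEq ι] {L : ι → Leg} {I : ι → Type}
    (A : ∀ k, OpSystem (L k) (I k)) (e : ∀ k, (L k).Event) :
    tensorOp (fun k => A k (e k)) ∈ Algebra.adjoin ℂ (Set.range (localOps A)) := by
  have key : ∀ s : Finset ι, tensorOp (s.piecewise (fun k => A k (e k)) 1)
      ∈ Algebra.adjoin ℂ (Set.range (localOps A)) := fun s => by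
    induction s using Finset.induction_on with
    | empty =>
      rw [Finset.piecewise_empty]
      exact tensorOp_one (I := I) ▸ one_mem _
    | insert k s hk ih =>
      rw [tensorOp_piecewise_insert _ hk]
      exact mul_mem (Algebra.subset_adjoin ⟨⟨k, e k⟩, rfl⟩) ih
  simpa only [Finset.piecewise_univ] using key Finset.univ

theorem bellOp_mem_adjoin {ι : Type} [Fintype ι] [DecidableEq ι] {L : ι → Leg} {I : ι → Type}
    (B : BellFunctional L) (A : ∀ k, OpSystem (L k) (I k)) :
    bellOp B A ∈ Algebra.adjoin ℂ (Set.range (localOps A)) :=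
  sum_mem fun e _ => Subalgebra.smul_mem _ (tensorOp_mem_adjoin A e) _

theorem ampl_mem_adjoin_bipartiteOps {I R α β : Type} {T : α → Op I I} {f : Op I I}
    (hf : f ∈ Algebra.adjoin ℂ (Set.range T)) (S : β → Op R R) :
    ampl R f ∈ Algebra.adjoin ℂ (Set.range (bipartiteOps T S)) := by
  have h : (amplHom I R : Op I I →ₐ[ℂ] Op (I × R) (I × R)) f
      ∈ (Algebra.adjoin ℂ (Set.range T)).map (amplHom I R : Op I I →ₐ[ℂ] Op (I × R) (I × R)) :=
    ⟨f, hf, rfl⟩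
  rw [AlgHom.map_adjoin, ← Set.range_comp] at h
  refine Algebra.adjoin_mono ?_ h
  rintro _ ⟨a, rfl⟩
  exact ⟨.inl a, rfl⟩

theorem cyclicSubspace_bipartiteOps_ampl_eq_top {I O R α β γ : Type} [Finite I] [Finite R]
    {T : α → Op I I} {N : γ → Op I I} {M : γ → Op O O} {S : β → Op R R} {J : Op O I}
    (hN : ∀ c, N c ∈ Algebra.adjoin ℂ (Set.range T)) (hJ : Intertwines N M J) {χ : Hilb O}
    (hχ : cyclicSubspace T (J χ) = ⊤) {φ : Hilb (O × R)}
    (hφ : cyclicSubspace (bipartiteOps M S) φ = ⊤) :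
    cyclicSubspace (bipartiteOps T S) (ampl R J φ) = ⊤ := by
  cases nonempty_fintype I
  cases nonempty_fintype R
  set p := cyclicSubspace (bipartiteOps T S) (ampl R J φ)
  have hJp : cyclicSubspace (bipartiteOps M S) φ ≤ p.comap (ampl R J).toLinearMap := by
    refine cyclicSubspace_le (mem_cyclicSubspace_self _ _) ?_
    rintro (c | b) v hv
    · have hc : ampl R J (ampl R (M c) v) = ampl R (N c) (ampl R J v) :=
        congrArg (fun f => ampl R f v) (hJ c).symm
      change ampl R J (ampl R (M c) v) ∈ p
      rw [hc]
      exact map_mem_cyclicSubspace_of_mem_adjoin (ampl_mem_adjoin_bipartiteOps (hN c) S) hv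
    · have hb := DFunLike.congr_fun (ampl_comp_tensorOpProd_one J (S b)) v
      change ampl R J (tensorOpProd 1 (S b) v) ∈ p
      exact hb ▸ map_mem_cyclicSubspace _ hv (.inr b)
  have hembed (ρ : R) :
      cyclicSubspace T (J χ) ≤ p.comap (embedOp (.sectL I ρ)).toLinearMap := by
    refine cyclicSubspace_le ?_ fun a v hv => ?_
    · have h := DFunLike.congr_fun (ampl_comp_embedOp_sectL ρ J) χ
      change embedOp _ (J χ) ∈ p
      exact h ▸ hJp (hφ ▸ Submodule.mem_top)
    · have h := DFunLike.congr_fun (ampl_comp_embedOp_sectL ρ (T a)) v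
      change embedOp _ (T a v) ∈ p
      exact h ▸ map_mem_cyclicSubspace _ hv (.inl a)
  refine eq_top_iff.2 fun v _ => ?_
  rw [← sum_ket v]
  refine sum_mem fun i _ => p.smul_mem _ ?_
  have h : embedOp (.sectL I i.2) (ket i.1) ∈ p := hembed i.2 (hχ ▸ Submodule.mem_top)
  rwa [embedOp_ket] at h

variable {α β : Type} [Fintype α] [DecidableEq α] [Fintype β] [DecidableEq β]
  {L : α ⊕ β → Leg} {I J : α ⊕ β → Type} {A : ∀ k, OpSystem (L k) (I k)}
  {A' : ∀ k, OpSystem (L k) (J k)}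

theorem cyclicSubspace_localOps_of_bipartiteOps {φ : Hilb ((∀ a, I (.inl a)) × ∀ b, I (.inr b))}
    (hφ : cyclicSubspace (bipartiteOps (localOps fun a => A (.inl a))
      (localOps fun b => A (.inr b))) φ = ⊤) :
    cyclicSubspace (localOps A) (reindexOp (Equiv.sumPiEquivProdPi I).symm φ) = ⊤ := by
  have h := ((intertwines_reindexOp_sumPi A).symm
    (e := (reindex (Equiv.sumPiEquivProdPi I)).toContinuousLinearEquiv)).map_cyclicSubspace φ
  rw [cyclicSubspace_comp (sumEvent_surjective L), hφ, Submodule.map_top] at h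
  exact h.symm.trans
    (LinearMap.range_eq_top.2 (reindex (Equiv.sumPiEquivProdPi I)).symm.surjective)

theorem intertwines_localOps_of_bipartiteOps
    {W : Op ((∀ a, I (.inl a)) × ∀ b, I (.inr b)) ((∀ a, J (.inl a)) × ∀ b, J (.inr b))}
    (h : Intertwines (bipartiteOps (localOps fun a => A' (.inl a)) (localOps fun b => A' (.inr b)))
      (bipartiteOps (localOps fun a => A (.inl a)) (localOps fun b => A (.inr b))) W) :
    Intertwines (localOps A') (localOps A) (reindexOp (Equiv.sumPiEquivProdPi J).symm ∘L W ∘L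
      reindexOp (Equiv.sumPiEquivProdPi I)) := fun p => by
  obtain ⟨p, rfl⟩ := sumEvent_surjective L p
  have hsymm := (intertwines_reindexOp_sumPi A').symm
    (e := (reindex (Equiv.sumPiEquivProdPi J)).toContinuousLinearEquiv)
  exact hsymm.comp (h.comp (intertwines_reindexOp_sumPi A)) p

end Cyclic

namespace ConnectorData

variable {out : Party}

section Single

variable {X : ConnectorData out} {μ : out.Event → ℝ} {ψ : X.Space}

theorem IsFullySelfTesting.invariantSubspace_eq (h : X.IsFullySelfTesting μ ψ) :
    X.invariantSubspace = cyclicSubspace (connOp X.C X.A) ψ :=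
  SetLike.coe_injective (h.cyclic.trans (coe_cyclicSubspace _ _).symm)

theorem IsConnectorComplex.apply_adjoint (hX : X.IsConnectorComplex) (x : Hilb (Fin out.dim)) :
    X.V ((X.V†) x) = x :=
  DFunLike.congr_fun hX.coisometry x

theorem IsFullySelfTesting.intertwines_adjoint (h : X.IsFullySelfTesting μ ψ)
    (hX : X.IsConnectorComplex) : Intertwines (connOp X.C X.A) X.M (X.V†) := by
  intro o
  ext1 x
  have hx : connOp X.C X.A o ((X.V†) x) ∈ X.invariantSubspace := by
    rw [h.invariantSubspace_eq]
    refine map_mem_cyclicSubspace _ ?_ o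
    rw [← h.invariantSubspace_eq]
    exact ⟨x, rfl⟩
  obtain ⟨y, hy : (X.V†) y = _⟩ := hx
  change connOp X.C X.A o ((X.V†) x) = (X.V†) (X.V (connOp X.C X.A o ((X.V†) x)))
  rw [← hy, hX.apply_adjoint]

/-- The isometry `V†` of a connector complex. -/
noncomputable def IsConnectorComplex.embedding (hX : X.IsConnectorComplex) :
    Hilb (Fin out.dim) →ₗᵢ[ℂ] X.Space where
  toLinearMap := (X.V†).toLinearMap
  norm_map' := (X.V†).norm_map_iff_adjoint_comp_self.2 <| by
    rw [ContinuousLinearMap.adjoint_adjoint]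
    exact hX.coisometry

theorem IsFullySelfTesting.exists_cyclic_preimage (h : X.IsFullySelfTesting μ ψ)
    (hX : X.IsConnectorComplex) :
    ∃ χ, (X.V†) χ = ψ ∧ cyclicSubspace X.M χ = ⊤ := by
  obtain ⟨χ, rfl⟩ := h.mem_invariant
  refine ⟨χ, rfl, Submodule.map_injective_of_injective hX.embedding.injective ?_⟩
  rw [Submodule.map_top]
  exact ((h.intertwines_adjoint hX).map_cyclicSubspace χ).trans h.invariantSubspace_eq.symm

end Single

section Contraction

variable {X₂ : ConnectorData out} {k : X₂.ι} {X₁ : ConnectorData (X₂.party k)}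

theorem intertwines_connOp_contract {I : X₁.ι ⊕ {j : X₂.ι // j ≠ k} → Type}
    (A : ∀ j, OpSystem (contractParty X₂ k X₁ j).toLeg (I j)) :
    Intertwines (fun o => splitBellOp k (X₂.C o) (connOp X₁.C fun l => A (.inl l))
        fun j => A (.inr j))
      (connOp (contract X₂ k X₁).C A) (reindexOp (Equiv.sumPiEquivProdPi I)) := fun o =>
  (congrArg (· ∘L reindexOp (Equiv.sumPiEquivProdPi I)) (splitBellOp_connOp _ _ _ _)).trans
    (reindexOp_sumPi_comp_bellOp (L := fun j => (contractParty X₂ k X₁ j).toLeg)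
      ((contract X₂ k X₁).C o) A).symm

theorem reindexOp_sumPi_comp_bellOp_contract {I : X₁.ι ⊕ {j : X₂.ι // j ≠ k} → Type}
    (A : ∀ j, OpSystem (contractParty X₂ k X₁ j).toLeg (I j)) (μ : out.Event → ℝ) :
    reindexOp (Equiv.sumPiEquivProdPi I) ∘L bellOp ((contract X₂ k X₁).bell μ) A
      = splitBellOp k (X₂.bell μ) (connOp X₁.C fun l => A (.inl l)) (fun j => A (.inr j))
        ∘L reindexOp (Equiv.sumPiEquivProdPi I) := by
  have h := (intertwines_connOp_contract A).sum_smul fun o => (μ o : ℂ)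
  exact (congrArg (_ ∘L ·) (bellOp_sum_mul (contract X₂ k X₁).C μ A)).trans <|
    h.symm.trans (congrArg (· ∘L _) (splitBellOp_sum_mul X₂.C μ _ _).symm)

theorem inner_splitBellOp_reindexOp_sumPi {I : X₁.ι ⊕ {j : X₂.ι // j ≠ k} → Type}
    (A : ∀ j, OpSystem (contractParty X₂ k X₁ j).toLeg (I j)) (μ : out.Event → ℝ)
    (v : Hilb (∀ j, I j)) :
    inner ℂ (reindex (Equiv.sumPiEquivProdPi I) v)
        (splitBellOp k (X₂.bell μ) (connOp X₁.C fun l => A (.inl l)) (fun j => A (.inr j))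
          (reindex (Equiv.sumPiEquivProdPi I) v))
      = inner ℂ v (bellOp ((contract X₂ k X₁).bell μ) A v) :=
  (congrArg (inner ℂ _)
    (DFunLike.congr_fun (reindexOp_sumPi_comp_bellOp_contract A μ) v).symm).trans
      ((reindex (Equiv.sumPiEquivProdPi I)).inner_map_map _ _)

variable (X₂ k X₁) in
theorem adjoint_plug :
    ((plug X₂ k X₁)†) = reindexOp (Equiv.sumPiEquivProdPi
        fun j => Fin (contractParty X₂ k X₁ j).dim).symm ∘L
      ampl (∀ j : {j : X₂.ι // j ≠ k}, Fin (X₂.party j).dim) (X₁.V†) ∘L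
      reindexOp (Equiv.piSplitAt k fun j => Fin (X₂.party j).dim) :=
  adjoint_reindexOp_symm_comp_ampl_comp_reindexOp _ _ _

theorem IsConnectorComplex.plug_comp_adjoint (hX₁ : X₁.IsConnectorComplex) :
    plug X₂ k X₁ ∘L ((plug X₂ k X₁)†) = 1 :=
  reindexOp_symm_comp_ampl_comp_adjoint _ _ hX₁.coisometry

variable {μ₁ : (X₂.party k).Event → ℝ} {ψ₁ : X₁.Space}

theorem intertwines_adjoint_plug (hX₁ : X₁.IsConnectorComplex)
    (hψ₁ : X₁.IsFullySelfTesting μ₁ ψ₁) (congruent : X₁.M = X₂.A k) :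
    Intertwines (connOp (contract X₂ k X₁).C (contract X₂ k X₁).A) (connOp X₂.C X₂.A)
      ((plug X₂ k X₁)†) := by
  have h₁ := (intertwines_connOp_contract (contract X₂ k X₁).A).symm
    (e := (reindex (Equiv.sumPiEquivProdPi
      fun j => Fin (contractParty X₂ k X₁ j).dim)).toContinuousLinearEquiv)
  have h₂ : Intertwines (fun o => splitBellOp k (X₂.C o) (connOp X₁.C X₁.A) fun j => X₂.A j)
      (fun o => splitBellOp k (X₂.C o) (X₂.A k) fun j => X₂.A j) (ampl _ (X₁.V†)) := fun o =>
    splitBellOp_comp_ampl _ _ (congruent ▸ hψ₁.intertwines_adjoint hX₁)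
  have h₃ : Intertwines (fun o => splitBellOp k (X₂.C o) (X₂.A k) fun j => X₂.A j)
      (connOp X₂.C X₂.A) (reindexOp (Equiv.piSplitAt k fun j => Fin (X₂.party j).dim)) := fun o =>
    (reindexOp_piSplitAt_comp_bellOp k (X₂.C o) X₂.A).symm
  exact (congrArg (Intertwines _ _) (adjoint_plug X₂ k X₁)).mpr (h₁.comp (h₂.comp h₃))

theorem IsConnectorComplex.isPOVM_contract (hX₂ : X₂.IsConnectorComplex)
    (hX₁ : X₁.IsConnectorComplex) : ∀ j, IsPOVM ((contract X₂ k X₁).A j)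
  | .inl l => hX₁.povm l
  | .inr j => hX₂.povm j

theorem IsConnectorComplex.isConnector_contract (hX₂ : X₂.IsConnectorComplex)
    (hX₁ : X₁.IsConnectorComplex) : IsConnector (contract X₂ k X₁).C := fun I A hA => by
  have h := hX₂.connector.isPOVM_splitBellOp k _ _ _ _ (hX₁.connector _ _ fun l => hA (.inl l))
    fun j => hA (.inr j)
  exact h.of_reindex (Equiv.sumPiEquivProdPi I).symm <|
    (intertwines_connOp_contract A).symm (e := (reindex _).toContinuousLinearEquiv)

theorem M_contract (hX₁ : X₁.IsConnectorComplex) (hψ₁ : X₁.IsFullySelfTesting μ₁ ψ₁)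
    (congruent : X₁.M = X₂.A k) : (contract X₂ k X₁).M = X₂.M := by
  funext o
  ext1 x
  have hplug (v) : plug X₂ k X₁ ((plug X₂ k X₁†) v) = v :=
    DFunLike.congr_fun hX₁.plug_comp_adjoint v
  have hconn := (intertwines_adjoint_plug hX₁ hψ₁ congruent).apply o ((X₂.V†) x)
  change X₂.V (plug X₂ k X₁ (connOp (contract X₂ k X₁).C (contract X₂ k X₁).A o
    (((X₂.V ∘L plug X₂ k X₁)†) x))) = X₂.V (connOp X₂.C X₂.A o ((X₂.V†) x))
  rw [ContinuousLinearMap.adjoint_comp, ContinuousLinearMap.comp_apply]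
  exact congrArg X₂.V ((congrArg (plug X₂ k X₁) hconn).trans (hplug _))

theorem isConnectorComplex_contract (hX₂ : X₂.IsConnectorComplex) (hX₁ : X₁.IsConnectorComplex)
    (hψ₁ : X₁.IsFullySelfTesting μ₁ ψ₁) (congruent : X₁.M = X₂.A k) :
    (contract X₂ k X₁).IsConnectorComplex where
  connector := hX₂.isConnector_contract hX₁
  povm := hX₂.isPOVM_contract hX₁
  coisometry := by
    change (X₂.V ∘L plug X₂ k X₁) ∘L ((X₂.V ∘L plug X₂ k X₁)†) = 1
    rw [ContinuousLinearMap.adjoint_comp, ContinuousLinearMap.comp_assoc,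
      ← ContinuousLinearMap.comp_assoc (plug X₂ k X₁), hX₁.plug_comp_adjoint]
    exact hX₂.coisometry
  projective := by
    rw [M_contract hX₁ hψ₁ congruent]
    exact hX₂.projective

variable {μ₂ : out.Event → ℝ} {ψ₂ : X₂.Space}

theorem IsConnectorComplex.norm_adjoint_plug (hX₁ : X₁.IsConnectorComplex) (v : X₂.Space) :
    ‖(plug X₂ k X₁†) v‖ = ‖v‖ :=
  ((plug X₂ k X₁)†).norm_map_iff_adjoint_comp_self.2
    ((congrArg (· ∘L _) (ContinuousLinearMap.adjoint_adjoint _)).trans hX₁.plug_comp_adjoint) v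

theorem bellOp_contract_apply_state (hX₁ : X₁.IsConnectorComplex)
    (hψ₂ : X₂.IsFullySelfTesting μ₂ ψ₂) (hψ₁ : X₁.IsFullySelfTesting μ₁ ψ₁)
    (congruent : X₁.M = X₂.A k) :
    bellOp ((contract X₂ k X₁).bell μ₂) (contract X₂ k X₁).A (contractState X₂ k X₁ ψ₂)
      = contractState X₂ k X₁ ψ₂ := by
  have h := (intertwines_adjoint_plug hX₁ hψ₁ congruent).sum_smul fun o => (μ₂ o : ℂ)
  rw [← bellOp_sum_mul, ← bellOp_sum_mul] at h
  exact (DFunLike.congr_fun h ψ₂).trans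
    (congrArg (plug X₂ k X₁†) hψ₂.self_tests.bellOp_apply_state)

theorem re_inner_bellOp_contract_le (h : IsNormalized (X₂.bell μ₂)) (hX₁ : X₁.IsConnectorComplex)
    {I : X₁.ι ⊕ {j : X₂.ι // j ≠ k} → Type}
    {A : ∀ j, OpSystem (contractParty X₂ k X₁ j).toLeg (I j)} (hA : ∀ j, IsPOVM (A j))
    (v : Hilb (∀ j, I j)) :
    (inner ℂ v (bellOp ((contract X₂ k X₁).bell μ₂) A v)).re ≤ ‖v‖ ^ 2 := by
  have hle := h.re_inner_splitBellOp_le k _ _ _ _ (hX₁.connector _ _ fun l => hA (.inl l))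
    (fun j => hA (.inr j)) (reindex (Equiv.sumPiEquivProdPi I) v)
  have hnorm := (reindex (Equiv.sumPiEquivProdPi I)).norm_map v
  exact (congrArg Complex.re (inner_splitBellOp_reindexOp_sumPi A μ₂ v).symm).trans_le
    (hle.trans_eq (congrArg (· ^ 2) hnorm))

theorem isNormalized_contract (hX₂ : X₂.IsConnectorComplex) (hX₁ : X₁.IsConnectorComplex)
    (hψ₂ : X₂.IsFullySelfTesting μ₂ ψ₂) (hψ₁ : X₁.IsFullySelfTesting μ₁ ψ₁)
    (congruent : X₁.M = X₂.A k) : IsNormalized ((contract X₂ k X₁).bell μ₂) := by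
  have hnorm : ‖contractState X₂ k X₁ ψ₂‖ = 1 :=
    (hX₁.norm_adjoint_plug ψ₂).trans hψ₂.self_tests.norm_state
  constructor
  · refine ⟨_, (contract X₂ k X₁).A, _, hX₂.isPOVM_contract hX₁, hnorm, ?_⟩
    rw [bellOp_contract_apply_state hX₁ hψ₂ hψ₁ congruent, ← RCLike.re_to_complex,
      inner_self_eq_norm_sq (𝕜 := ℂ), hnorm, one_pow]
  · rintro _ ⟨I, A, ψ, hA, hψ, rfl⟩
    exact (re_inner_bellOp_contract_le hψ₂.self_tests.normalized hX₁ hA ψ).trans_eq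
      ((congrArg (· ^ 2) hψ).trans (one_pow 2))

theorem cyclicSubspace_contract_eq_top (hX₁ : X₁.IsConnectorComplex)
    (hψ₂ : X₂.IsFullySelfTesting μ₂ ψ₂) (hψ₁ : X₁.IsFullySelfTesting μ₁ ψ₁)
    (congruent : X₁.M = X₂.A k) :
    cyclicSubspace (localOps (contract X₂ k X₁).A) (contractState X₂ k X₁ ψ₂) = ⊤ := by
  obtain ⟨χ, hχ, -⟩ := hψ₁.exists_cyclic_preimage hX₁
  have h₂ : cyclicSubspace (bipartiteOps (X₂.A k) (localOps fun j : {j // j ≠ k} => X₂.A j))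
      (reindexOp (Equiv.piSplitAt k fun j => Fin (X₂.party j).dim) ψ₂) = ⊤ := by
    rw [← (intertwines_reindexOp_piSplitAt k X₂.A).map_cyclicSubspace,
      cyclicSubspace_comp (splitEvent_surjective _ k), hψ₂.self_tests.cyclicSubspace_eq_top,
      Submodule.map_top]
    exact LinearMap.range_eq_top.2 (reindex _).surjective
  have h₁ := cyclicSubspace_bipartiteOps_ampl_eq_top (fun c => bellOp_mem_adjoin (X₁.C c) X₁.A)
    (congruent ▸ hψ₁.intertwines_adjoint hX₁) (hχ ▸ hψ₁.self_tests.cyclicSubspace_eq_top) h₂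
  have h := cyclicSubspace_localOps_of_bipartiteOps (A := (contract X₂ k X₁).A) h₁
  exact (congrArg (fun v : (contract X₂ k X₁).Space =>
    cyclicSubspace (localOps (contract X₂ k X₁).A) v)
      (DFunLike.congr_fun (adjoint_plug X₂ k X₁) ψ₂)).trans h

theorem exists_linearIsometry_contract (hX₁ : X₁.IsConnectorComplex)
    (hψ₂ : X₂.IsFullySelfTesting μ₂ ψ₂) (hψ₁ : X₁.IsFullySelfTesting μ₁ ψ₁)
    (congruent : X₁.M = X₂.A k) {I : X₁.ι ⊕ {j : X₂.ι // j ≠ k} → Type}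
    {A : ∀ j, OpSystem (contractParty X₂ k X₁ j).toLeg (I j)} (hA : ∀ j, IsPOVM (A j))
    {ψ : Hilb (∀ j, I j)} (hψ : ‖ψ‖ = 1)
    (hv : (inner ℂ ψ (bellOp ((contract X₂ k X₁).bell μ₂) A ψ)).re = 1) :
    ∃ W : Hilb (∀ j, Fin (contractParty X₂ k X₁ j).dim) →ₗᵢ[ℂ] Hilb (∀ j, I j),
      W (contractState X₂ k X₁ ψ₂) = ψ ∧
      Intertwines (localOps A) (localOps (contract X₂ k X₁).A) W.toContinuousLinearMap := by
  let e := reindex (Equiv.sumPiEquivProdPi I)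
  let e' := reindex (Equiv.sumPiEquivProdPi fun j => Fin (contractParty X₂ k X₁ j).dim)
  have hval := (congrArg Complex.re (inner_splitBellOp_reindexOp_sumPi A μ₂ ψ)).trans hv
  obtain ⟨W₂, hW₂ψ, hW₂⟩ := hψ₂.self_tests.exists_linearIsometry_split k _ _ _ _
    (hX₁.connector _ _ fun l => hA (.inl l)) (fun j => hA (.inr j)) (e ψ)
    ((e.norm_map ψ).trans hψ) hval
  obtain ⟨χ, hχ, hcyc⟩ := hψ₁.exists_cyclic_preimage hX₁
  obtain ⟨W, hWV, hW⟩ := hψ₁.self_tests.exists_linearIsometry_extension (J := hX₁.embedding)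
    (M := X₁.M) (hψ₁.intertwines_adjoint hX₁) hχ hcyc (fun l => hA (.inl l)) W₂ (congruent ▸ hW₂)
  have hlocal := intertwines_localOps_of_bipartiteOps (A := (contract X₂ k X₁).A) (A' := A) hW
  refine ⟨e.symm.toLinearIsometry.comp (W.comp e'.toLinearIsometry), ?_, hlocal⟩
  have hstate : e' (contractState X₂ k X₁ ψ₂) = ampl _ (X₁.V†) (reindexOp (.piSplitAt k _) ψ₂) :=
    (congrArg e' (DFunLike.congr_fun (adjoint_plug X₂ k X₁) ψ₂)).trans (e'.apply_symm_apply _)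
  change e.symm (W (e' _)) = ψ
  rw [hstate, e.symm_apply_eq, ← hW₂ψ]
  exact DFunLike.congr_fun hWV _

theorem fullySelfTests_contract (hX₂ : X₂.IsConnectorComplex) (hX₁ : X₁.IsConnectorComplex)
    (hψ₂ : X₂.IsFullySelfTesting μ₂ ψ₂) (hψ₁ : X₁.IsFullySelfTesting μ₁ ψ₁)
    (congruent : X₁.M = X₂.A k) :
    FullySelfTests ((contract X₂ k X₁).bell μ₂) (contract X₂ k X₁).A
      (contractState X₂ k X₁ ψ₂) := by
  refine fullySelfTests_of_forall_exists_linearIsometry ?_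
    ((hX₁.norm_adjoint_plug ψ₂).trans hψ₂.self_tests.norm_state)
    (cyclicSubspace_contract_eq_top hX₁ hψ₂ hψ₁ congruent)
    (isNormalized_contract hX₂ hX₁ hψ₂ hψ₁ congruent) ?_
    fun I A ψ hA hψ hv => exists_linearIsometry_contract hX₁ hψ₂ hψ₁ congruent hA hψ hv
  · rintro (l | j)
    exacts [hψ₁.self_tests.projective l, hψ₂.self_tests.projective j]
  · rintro (l | j)
    exacts [hψ₁.self_tests.adjoin_range_eq_top l, hψ₂.self_tests.adjoin_range_eq_top j]

theorem isFullySelfTesting_contract (hX₂ : X₂.IsConnectorComplex) (hX₁ : X₁.IsConnectorComplex)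
    (hψ₂ : X₂.IsFullySelfTesting μ₂ ψ₂) (hψ₁ : X₁.IsFullySelfTesting μ₁ ψ₁)
    (congruent : X₁.M = X₂.A k) :
    (contract X₂ k X₁).IsFullySelfTesting μ₂ (contractState X₂ k X₁ ψ₂) := by
  have hV : ((contract X₂ k X₁).V†) = (plug X₂ k X₁†) ∘L (X₂.V†) :=
    ContinuousLinearMap.adjoint_comp _ _
  have hinv : (contract X₂ k X₁).invariantSubspace
      = X₂.invariantSubspace.map (plug X₂ k X₁†).toLinearMap :=
    (congrArg (fun T : Hilb (Fin out.dim) →L[ℂ] (contract X₂ k X₁).Space =>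
      LinearMap.range T.toLinearMap) hV).trans (LinearMap.range_comp _ _)
  refine ⟨fullySelfTests_contract hX₂ hX₁ hψ₂ hψ₁ congruent, ?_, ?_⟩
  · rw [hinv]
    exact ⟨ψ₂, hψ₂.mem_invariant, rfl⟩
  · rw [hinv, hψ₂.invariantSubspace_eq]
    exact (congrArg SetLike.coe
      ((intertwines_adjoint_plug hX₁ hψ₁ congruent).map_cyclicSubspace ψ₂)).trans
        (coe_cyclicSubspace _ _)

end Contraction

theorem IsCongruentContraction.isFullySelfTesting {n : ℕ} {X : ConnectorData out}
    {μ : out.Event → ℝ} {ψ : X.Space} (h : X.IsCongruentContraction n μ ψ) :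
    X.IsConnectorComplex ∧ X.IsFullySelfTesting μ ψ := by
  induction h with
  | single X μ ψ hX hψ => exact ⟨hX, hψ⟩
  | contract X₂ μ₂ ψ₂ k X₁ μ₁ ψ₁ _ _ congruent ih₁ ih₂ =>
    exact ⟨isConnectorComplex_contract ih₂.1 ih₁.1 ih₁.2 congruent,
      isFullySelfTesting_contract ih₂.1 ih₁.1 ih₂.2 ih₁.2 congruent⟩

end ConnectorData

end TightConnectors

open TightConnectors in
theorem mainTheorem3 {out : Party} (n : ℕ) (X : ConnectorData out) (μ : out.Event → ℝ)
    (ψ : X.Space) (h : X.IsCongruentContraction n μ ψ) :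
    X.IsConnectorComplex ∧ FullySelfTests (X.bell μ) X.A ψ :=
  ⟨h.isFullySelfTesting.1, h.isFullySelfTesting.2.self_tests⟩
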